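/- Let $\alpha_n,\gamma_n$ ($n\ge 0$) be real numbers with $\alpha_0=0$ and $\gamma_n,\alpha_{n+1}>0$ for all $n\ge 0$. Put $\beta_n=\alpha_n+\gamma_n$, $\lambda_n=\sqrt{\alpha_{n+1}\gamma_n}$, and $h(n)=\dfrac{\gamma_0\gamma_1\cdots\gamma_{n-1}}{\alpha_1\alpha_2\cdots\alpha_n}$ with $h(0)=1$. Let $R_n$ be the polynomials determined by $R_0=1$ and $$xR_n(x)=-\gamma_nR_{n+1}(x)+\beta_nR_n(x)-\alpha_nR_{n-1}(x),\qquad n\ge 0 .$$ Write $a_n\approx b_n$ if $a_n/b_n$ has a positive limit as $n\to\infty$, and $a_n\sim b_n$ if there are constants $0<m\le M$ with $m\le a_n/b_n\le M$ for all indices $n$ under consideration. Suppose that there are real constants $q,\kappa,s,c$ and a natural number $N$ such that - $0<q<1$, $\alpha_n\approx q^n$ and $\gamma_n\approx q^n$; - $1\le\kappa<q^{-1}+q-1$ and $\alpha_n\le\kappa\gamma_n$ for all $n\ge 0$; - $s>1$ and $h(n)\sim s^n$ ($n\ge 0$); - $\dfrac{1+q}{1+q^2}<c<\dfrac1q$ and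 $\lambda_n\le\beta_{n+1}-c\beta_{n+2}$ for all $n\ge 0$; - $\beta_1\le\beta_0$; - $\beta_n-c\beta_{n+1}\ge\beta_{n+1}-c\beta_{n+2}$ for all $n\ge N$. Then there is exactly one Borel probability measure $\mu$ on $\mathbb R$ with finite moments for which the polynomials $R_n$ are pairwise orthogonal. This measure is concentrated on a strictly decreasing sequence $(\xi_n)_{n\ge 1}$, that is, $\mu(\mathbb R\setminus\{\xi_n:n\ge 1\})=0$, and $\mu(\{\xi_n\})>0$ for every $n\ge 1$. Moreover, $\xi_n\sim q^n$ ($n\ge 1$); the quantity $1-\xi_{n+1}/\xi_n$ ($n\ge1$) is bounded away from $0$, i.e. bounded below by a positive constant; $\mu(\{0\})=0$; and $\mu([0,\xi_n])\sim s^{-n}$ ($n\ge 1$). -/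

import Mathlib

open Polynomial Filter Topology MeasureTheory

namespace OrthPoly

/-- The diagonal coefficients `β n = α n + γ n`. -/
def beta (α γ : ℕ → ℝ) (n : ℕ) : ℝ := α n + γ n

/-- The off-diagonal Jacobi coefficients `λ n = √(α (n+1) * γ n)`. -/
noncomputable def lam (α γ : ℕ → ℝ) (n : ℕ) : ℝ := Real.sqrt (α (n + 1) * γ n)

/-- `h n = (γ 0 ⋯ γ (n-1)) / (α 1 ⋯ α n)`, with `h 0 = 1`. -/
noncomputable def h (α γ : ℕ → ℝ) (n : ℕ) : ℝ :=
  (∏ k ∈ Finset.range n, γ k) / (∏ k ∈ Finset.range n, α (k + 1))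

/-- The polynomials `R n` satisfy the three-term recurrence
`x R_n = - γ_n R_{n+1} + β_n R_n - α_n R_{n-1}` with `R_0 = 1`, `α_0 = 0`, `β_n = α_n + γ_n` and
`γ_n, α_{n+1} > 0`. The equation for `n = 0`, where `α_0 = 0`, is stated separately. -/
structure NormalizedRecurrence (α γ : ℕ → ℝ) (R : ℕ → ℝ[X]) : Prop where
  alpha_zero : α 0 = 0
  alpha_pos : ∀ n, 0 < α (n + 1)
  gamma_pos : ∀ n, 0 < γ n
  R_zero : R 0 = 1
  rec_zero : X * R 0 = -(C (γ 0) * R 1) + C (beta α γ 0) * R 0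
  rec_succ : ∀ n, X * R (n + 1) =
    -(C (γ (n + 1)) * R (n + 2)) + C (beta α γ (n + 1)) * R (n + 1) - C (α (n + 1)) * R n

/-- `μ` is a (normalized) orthogonality measure on the real line for the polynomials `R n`: a Borel
probability measure with finite moments for which distinct `R n` are orthogonal. -/
structure IsOrthogonalityMeasure (R : ℕ → ℝ[X]) (μ : Measure ℝ) : Prop where
  isProbabilityMeasure : IsProbabilityMeasure μ
  integrable_pow : ∀ n : ℕ, Integrable (fun x : ℝ => x ^ n) μ
  orthogonal : ∀ m n : ℕ, m ≠ n → ∫ x, (R m).eval x * (R n).eval x ∂μ = 0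

/-- `a n ≈ b n`: the ratio `a n / b n` has a positive limit. -/
def RatioHasPosLimit (a b : ℕ → ℝ) : Prop :=
  ∃ L : ℝ, 0 < L ∧ Tendsto (fun n => a n / b n) atTop (𝓝 L)

/-- `a n ∼ b n` for the indices `n ≥ k`: the ratio `a n / b n` is positive, bounded, and bounded away
from zero. -/
def SimFrom (k : ℕ) (a b : ℕ → ℝ) : Prop :=
  ∃ m M : ℝ, 0 < m ∧ ∀ n, k ≤ n → m ≤ a n / b n ∧ a n / b n ≤ M

end OrthPoly

/-! On `ℓ²` with basis `e n`, let J be the sum of the rank one operators given by `b n = √γ_n e_n -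
√α_{n+1} e_{n+1}`. Its matrix has diagonal `β_n` and off-diagonal entries `-λ_n`, and the numbers
`√(h n) * R_n(x)` formally solve the eigenvector equation. Since `‖b n‖² = O(q^n)`, J is compact,
symmetric and nonnegative. Its eigenvalues are simple and positive, and its eigenvectors `w k`,
normalized to have zeroth coordinate 1, are complete. Parseval's identity then says that the masses
`1/‖w k‖²` at the eigenvalues form an orthogonality measure. It has bounded support, so its moments
determine it.

Eigenvalues: `ξ k ≲ q^k`, because the form of J is `O(q^n)` on vectors whose first n coordinates
vanish (`abs_inner_jacobi_le`). `ξ k ≳ q^k`, because the form is at least a multiple of `q^n` on the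
span of the first n basis vectors (`norm_sq_le_inner_jacobi`, a discrete Hardy inequality). A
dimension count turns both into statements on eigenvalues.

Masses: a discrete Grönwall argument (`solution_bound`) shows that `R_n(x)` is near 1 while x is
small against `q^n`, and stays bounded while x is comparable to it. As `w k` has most of its norm in
the first `k + K` coordinates, with K independent of k (`exists_tail_le`), `‖w k‖²` is comparable to
the sum of `h j` up to about k, that is, to `s^k`.

Separation: if `ξ (k+1) / ξ k` were near 1, a Lipschitz form of Grönwall (`solution_lipschitz`)
would make the heads of `w k` and `w (k+1)` nearly equal, which orthogonality and small tails
forbid. -/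

namespace OrthPoly

/-! ### Growth of the solutions of the recurrence -/

/-- Two-sided geometric bounds on the recurrence coefficients and on `h`. -/
structure GeomBounds (α γ : ℕ → ℝ) (q s B g m M : ℝ) : Prop where
  q_pos : 0 < q
  q_lt_one : q < 1
  one_lt_s : 1 < s
  alpha_pos : ∀ n, 0 < α (n + 1)
  gamma_pos : ∀ n, 0 < γ n
  add_le : ∀ n, γ n + α (n + 1) ≤ B * q ^ n
  g_pos : 0 < g
  le_gamma : ∀ n, g * q ^ n ≤ γ n
  m_pos : 0 < m
  le_h : ∀ n, m * s ^ n ≤ h α γ n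
  h_le : ∀ n, h α γ n ≤ M * s ^ n

/-- The summed form of the three-term recurrence with spectral parameter `x`. -/
def IsSolution (α γ : ℕ → ℝ) (x : ℝ) (u : ℕ → ℝ) : Prop :=
  ∀ n, γ n * h α γ n * (u n - u (n + 1)) = x * ∑ j ∈ Finset.range (n + 1), h α γ j * u j

/-- The exponential growth rate of the solutions. -/
noncomputable def growthRate (q s g m M : ℝ) : ℝ :=
  M / m * (s / (s - 1)) / g * (q / (1 - q))

theorem h_zero (α γ : ℕ → ℝ) : h α γ 0 = 1 := by simp [h]

theorem alpha_mul_h_succ {α : ℕ → ℝ} (γ : ℕ → ℝ) (hα : ∀ n, 0 < α (n + 1)) (n : ℕ) :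
    α (n + 1) * h α γ (n + 1) = γ n * h α γ n := by
  have h1 : ∏ k ∈ Finset.range n, α (k + 1) ≠ 0 :=
    Finset.prod_ne_zero_iff.2 fun k _ => (hα k).ne'
  have h2 := (hα n).ne'
  simp only [h, Finset.prod_range_succ]
  field_simp

theorem h_pos {α γ : ℕ → ℝ} (hα : ∀ n, 0 < α (n + 1)) (hγ : ∀ n, 0 < γ n) (n : ℕ) :
    0 < h α γ n :=
  div_pos (Finset.prod_pos fun k _ => hγ k) (Finset.prod_pos fun k _ => hα k)

/-- Multiplied by `h (n+1)`, the recurrence telescopes because `α (n+1) * h (n+1) = γ n * h n`;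
there is no boundary term since `α 0 = 0`. -/
theorem NormalizedRecurrence.isSolution {α γ : ℕ → ℝ} {R : ℕ → ℝ[X]}
    (hR : NormalizedRecurrence α γ R) (x : ℝ) : IsSolution α γ x fun n => (R n).eval x := by
  intro n
  induction n with
  | zero =>
    have h0 := congrArg (eval x) hR.rec_zero
    simp [beta, hR.alpha_zero, hR.R_zero] at h0
    simp [h_zero, hR.R_zero]
    linarith
  | succ n ih =>
    have h1 := congrArg (eval x) (hR.rec_succ n)
    simp [beta] at h1
    rw [Finset.sum_range_succ, mul_add, ← ih]
    have h2 := alpha_mul_h_succ γ hR.alpha_pos n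
    linear_combination (-h α γ (n+1)) * h1 + ((R n).eval x - (R (n + 1)).eval x) * h2

/-- Each equation determines `u (n+1)` from the earlier values, so solutions form a line. This makes
the eigenvalues of the Jacobi operator simple. -/
theorem IsSolution.eq_mul {α γ : ℕ → ℝ} (hα : ∀ n, 0 < α (n + 1)) (hγ : ∀ n, 0 < γ n) {x : ℝ}
    {u v : ℕ → ℝ} (hu : IsSolution α γ x u) (hv : IsSolution α γ x v) (hv0 : v 0 = 1) (n : ℕ) :
    u n = u 0 * v n := by
  induction n using Nat.strong_induction_on with
  | _ n ih =>
    cases n with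
    | zero => simp [hv0]
    | succ n =>
      have hs : ∑ j ∈ Finset.range (n + 1), h α γ j * u j =
          u 0 * ∑ j ∈ Finset.range (n + 1), h α γ j * v j := by
        rw [Finset.mul_sum]
        refine Finset.sum_congr rfl fun j hj => ?_
        rw [ih j (Finset.mem_range.1 hj)]
        ring
      have h1 := hu n
      have h2 := hv n
      rw [hs, ih n n.lt_succ_self] at h1
      have h3 : γ n * h α γ n ≠ 0 := (mul_pos (hγ n) (h_pos hα hγ n)).ne'
      have h4 : γ n * h α γ n * (u (n + 1) - u 0 * v (n + 1)) = 0 := by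
        linear_combination u 0 * h2 - h1
      linarith [(mul_eq_zero.1 h4).resolve_left h3]

namespace GeomBounds

variable {α γ : ℕ → ℝ} {q s B g m M : ℝ}

theorem h_pos (hb : GeomBounds α γ q s B g m M) (n : ℕ) : 0 < h α γ n :=
  OrthPoly.h_pos hb.alpha_pos hb.gamma_pos n

theorem M_pos (hb : GeomBounds α γ q s B g m M) : 0 < M := by
  have h1 := hb.h_le 0
  rw [h_zero, pow_zero, mul_one] at h1
  linarith

theorem B_pos (hb : GeomBounds α γ q s B g m M) : 0 < B := by
  have h1 := hb.add_le 0
  have := hb.alpha_pos 0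
  have := hb.gamma_pos 0
  rw [pow_zero, mul_one] at h1
  linarith

theorem m_le_one (hb : GeomBounds α γ q s B g m M) : m ≤ 1 := by
  simpa [h_zero] using hb.le_h 0

theorem growthRate_pos (hb : GeomBounds α γ q s B g m M) : 0 < growthRate q s g m M := by
  have := hb.M_pos
  have := hb.m_pos
  have := hb.g_pos
  have := hb.q_pos
  have : 0 < 1 - q := by linarith [hb.q_lt_one]
  have : 0 < s - 1 := by linarith [hb.one_lt_s]
  have : 0 < s := by linarith [hb.one_lt_s]
  unfold growthRate
  positivity

theorem sum_pow_le (hs : 1 < s) (n : ℕ) :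
    ∑ j ∈ Finset.range (n + 1), s ^ j ≤ s ^ n * (s / (s - 1)) := by
  have h1 : 0 < s - 1 := by linarith
  rw [geom_sum_eq hs.ne', pow_succ, ← mul_div_assoc]
  gcongr
  linarith

theorem sum_h_le_pow (hb : GeomBounds α γ q s B g m M) (n : ℕ) :
    ∑ j ∈ Finset.range (n + 1), h α γ j ≤ M * (s / (s - 1)) * s ^ n := by
  calc _ ≤ ∑ j ∈ Finset.range (n + 1), M * s ^ j := Finset.sum_le_sum fun j _ => hb.h_le j
    _ = M * ∑ j ∈ Finset.range (n + 1), s ^ j := by rw [Finset.mul_sum]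
    _ ≤ M * (s ^ n * (s / (s - 1))) := by
        gcongr
        · exact hb.M_pos.le
        · exact sum_pow_le hb.one_lt_s n
    _ = _ := by ring

/-- The sum is dominated by its last term because s > 1. The factor `q / (1 - q)` in `growthRate`
turns the resulting `1 / q ^ n` into an increment of `1 / q ^ n`, so that later sums telescope. -/
theorem sum_h_le (hb : GeomBounds α γ q s B g m M) (n : ℕ) :
    ∑ j ∈ Finset.range (n + 1), h α γ j ≤
      growthRate q s g m M * (1 / q ^ (n + 1) - 1 / q ^ n) * (γ n * h α γ n) := by
  have hM := hb.M_pos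
  have hm := hb.m_pos
  have hg := hb.g_pos
  have hq := hb.q_pos
  have hq1 : 0 < 1 - q := by linarith [hb.q_lt_one]
  have hs1 : 0 < s - 1 := by linarith [hb.one_lt_s]
  have hs : 0 < s := by linarith [hb.one_lt_s]
  have e : growthRate q s g m M * (1 / q ^ (n + 1) - 1 / q ^ n) =
      M * (s / (s - 1)) / (g * q ^ n) / m := by
    unfold growthRate
    rw [pow_succ]
    field_simp
  calc _ ≤ _ := hb.sum_h_le_pow n
    _ = M * (s / (s - 1)) / (g * q ^ n) / m * (g * q ^ n * (m * s ^ n)) := by field_simp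
    _ ≤ M * (s / (s - 1)) / (g * q ^ n) / m * (γ n * h α γ n) := by
        gcongr
        · exact (hb.gamma_pos n).le
        · exact hb.le_gamma n
        · exact hb.le_h n
    _ = _ := by rw [e]

/-- The increment of a solution of the inhomogeneous recurrence is controlled by the increment of
an exponential. -/
theorem abs_le_of_mul_eq (hb : GeomBounds α γ q s B g m M) {n : ℕ} {d z W : ℝ} {w : ℕ → ℝ}
    (hz : 0 ≤ z) (hW : ∀ j ≤ n, |w j| ≤ W)
    (hd : γ n * h α γ n * |d| ≤ z * |∑ j ∈ Finset.range (n + 1), h α γ j * w j|) :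
    |d| ≤ W * (growthRate q s g m M * z / q ^ (n + 1) - growthRate q s g m M * z / q ^ n) := by
  have hW0 : 0 ≤ W := (abs_nonneg _).trans (hW 0 n.zero_le)
  have h1 : |∑ j ∈ Finset.range (n + 1), h α γ j * w j| ≤
      (∑ j ∈ Finset.range (n + 1), h α γ j) * W := by
    refine (Finset.abs_sum_le_sum_abs _ _).trans ?_
    rw [Finset.sum_mul]
    refine Finset.sum_le_sum fun j hj => ?_
    rw [abs_mul, abs_of_pos (hb.h_pos j)]
    exact mul_le_mul_of_nonneg_left (hW j (Nat.lt_succ_iff.1 (Finset.mem_range.1 hj)))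
      (hb.h_pos j).le
  have h2 := hb.sum_h_le n
  have h3 : 0 < γ n * h α γ n := mul_pos (hb.gamma_pos n) (hb.h_pos n)
  refine le_of_mul_le_mul_left ?_ h3
  calc _ ≤ _ := hd
    _ ≤ z * ((growthRate q s g m M * (1 / q ^ (n + 1) - 1 / q ^ n) * (γ n * h α γ n)) * W) := by
        gcongr
        exact h1.trans (by gcongr)
    _ = _ := by ring

/-- The tangent line of exp at a. It is the induction step of the discrete Grönwall arguments below.
-/
theorem exp_mul_sub_le (a b : ℝ) : Real.exp a * (b - a) ≤ Real.exp b - Real.exp a := by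
  have h1 := Real.add_one_le_exp (b - a)
  have h2 : Real.exp b = Real.exp a * Real.exp (b - a) := by rw [← Real.exp_add]; ring_nf
  rw [h2]
  nlinarith [Real.exp_pos a]

theorem div_pow_mono (hb : GeomBounds α γ q s B g m M) {z : ℝ} (hz : 0 ≤ z) {i j : ℕ}
    (hij : i ≤ j) : growthRate q s g m M * z / q ^ i ≤ growthRate q s g m M * z / q ^ j := by
  have := hb.growthRate_pos
  have := hb.q_pos
  refine div_le_div_of_nonneg_left (by positivity) (by positivity) ?_
  exact pow_le_pow_of_le_one hb.q_pos.le hb.q_lt_one.le hij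

/-- Discrete Grönwall: with `t n = growthRate * x / q ^ n`, the increment of u is at most `exp (t n)
* (t (n+1) - t n)`, hence at most the increment of `exp (t n)`. -/
theorem solution_bound (hb : GeomBounds α γ q s B g m M) {x : ℝ} {u : ℕ → ℝ} (hx : 0 ≤ x)
    (hu : IsSolution α γ x u) (hu0 : u 0 = 1) (n : ℕ) :
    |u n| ≤ Real.exp (growthRate q s g m M * x / q ^ n) ∧
      |u n - 1| ≤ Real.exp (growthRate q s g m M * x / q ^ n) - 1 := by
  induction n using Nat.strong_induction_on with
  | _ n ih =>
    suffices h2 : |u n - 1| ≤ Real.exp (growthRate q s g m M * x / q ^ n) - 1 by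
      refine ⟨?_, h2⟩
      have := abs_add_le (u n - 1) 1
      simp only [sub_add_cancel, abs_one] at this
      linarith
    cases n with
    | zero =>
      have := hb.growthRate_pos
      simp [hu0]
      positivity
    | succ n =>
      have h1 := hb.abs_le_of_mul_eq (n := n) (d := u n - u (n + 1)) (w := u)
        (W := Real.exp (growthRate q s g m M * x / q ^ n)) hx
        (fun j hj => (ih j (Nat.lt_succ_of_le hj)).1.trans
          (Real.exp_le_exp.2 (hb.div_pow_mono hx hj)))
        (by
          have h3 : 0 < γ n * h α γ n := mul_pos (hb.gamma_pos n) (hb.h_pos n)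
          rw [← abs_of_pos h3, ← abs_mul, hu n, abs_mul, abs_of_nonneg hx])
      have h2 := h1.trans (exp_mul_sub_le _ _)
      have h3 := (ih n n.lt_succ_self).2
      have h4 := abs_sub_le (u (n + 1)) (u n) 1
      rw [abs_sub_comm (u (n + 1)) (u n)] at h4
      linarith

/-- Grönwall for `u - v`, which solves the recurrence with source `(x - y) * v`. Here δ measures the
gap relative to the scale z. -/
theorem solution_lipschitz (hb : GeomBounds α γ q s B g m M) {x y z δ : ℝ} {u v : ℕ → ℝ}
    (hx : 0 ≤ x) (hy : 0 ≤ y) (hxz : x ≤ z) (hyz : y ≤ z) (hδ : |x - y| ≤ δ * z) (hδ0 : 0 ≤ δ) (hz0 : 0 < z)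
    (hu : IsSolution α γ x u) (hu0 : u 0 = 1) (hv : IsSolution α γ y v) (hv0 : v 0 = 1) (n : ℕ) :
    |u n - v n| ≤ δ * (Real.exp (growthRate q s g m M * (2 * z) / q ^ n) - 1) := by
  have hz : 0 ≤ z := hz0.le
  have hρ := hb.growthRate_pos
  have hq := hb.q_pos
  induction n using Nat.strong_induction_on with
  | _ n ih =>
    cases n with
    | zero =>
      have : (0 : ℝ) ≤ growthRate q s g m M * (2 * z) := by positivity
      rw [hu0, hv0, sub_self, abs_zero]
      exact mul_nonneg hδ0 (sub_nonneg.2 (Real.one_le_exp (by positivity)))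
    | succ n =>
      set E := Real.exp (growthRate q s g m M * (2 * z) / q ^ n) with hE
      have hvb : ∀ j ≤ n, |v j| ≤ E := fun j hj =>
        (hb.solution_bound hy hv hv0 j).1.trans <| Real.exp_le_exp.2 <|
          (hb.div_pow_mono hy hj).trans (by gcongr; linarith)
      have hdb : ∀ j ≤ n, |u j - v j| ≤ δ * E := fun j hj =>
        (ih j (Nat.lt_succ_of_le hj)).trans (by
          have := Real.exp_le_exp.2 (hb.div_pow_mono (z := 2 * z) (by linarith) hj)
          gcongr
          linarith)
      -- Both `x * (u - v)` and the source are at most `z * δ * E`; this is where the parameter `2 *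
      -- z` comes from.
      have h1 := hb.abs_le_of_mul_eq (n := n) (d := (u n - v n) - (u (n + 1) - v (n + 1)))
        (w := fun j => (x * (u j - v j) + (x - y) * v j) / (2 * z)) (W := δ * E)
        (z := 2 * z) (by linarith)
        (fun j hj => by
          rw [abs_div, abs_of_pos (by linarith : 0 < 2 * z), div_le_iff₀ (by linarith)]
          refine (abs_add_le _ _).trans ?_
          rw [abs_mul, abs_mul, abs_of_nonneg hx]
          have h5 := mul_le_mul hxz (hdb j hj) (abs_nonneg _) hz
          have h6 := mul_le_mul hδ (hvb j hj) (abs_nonneg _) (by positivity)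
          linarith)
        (by
          have h3 : 0 < γ n * h α γ n := mul_pos (hb.gamma_pos n) (hb.h_pos n)
          have e : 2 * z * ∑ j ∈ Finset.range (n + 1),
              h α γ j * ((x * (u j - v j) + (x - y) * v j) / (2 * z)) =
              x * ∑ j ∈ Finset.range (n + 1), h α γ j * u j -
                y * ∑ j ∈ Finset.range (n + 1), h α γ j * v j := by
            rw [Finset.mul_sum, Finset.mul_sum, Finset.mul_sum, ← Finset.sum_sub_distrib]
            refine Finset.sum_congr rfl fun j _ => ?_
            field_simp
            ring
          have e1 : γ n * h α γ n * ((u n - v n) - (u (n + 1) - v (n + 1))) =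
              2 * z * ∑ j ∈ Finset.range (n + 1),
                h α γ j * ((x * (u j - v j) + (x - y) * v j) / (2 * z)) := by
            rw [e, ← hu n, ← hv n]
            ring
          have e2 := congrArg abs e1
          rw [abs_mul, abs_of_pos h3, abs_mul, abs_of_pos (by linarith : 0 < 2 * z)] at e2
          exact e2.le)
      have h2 : |(u n - v n) - (u (n + 1) - v (n + 1))| ≤
          δ * (Real.exp (growthRate q s g m M * (2 * z) / q ^ (n + 1)) - E) := by
        refine h1.trans ?_
        rw [mul_assoc]
        gcongr
        exact exp_mul_sub_le _ _
      have h3 := ih n n.lt_succ_self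
      have h4 := abs_sub_abs_le_abs_sub (u (n + 1) - v (n + 1)) (u n - v n)
      rw [abs_sub_comm (u (n + 1) - v (n + 1))] at h4
      linarith

end GeomBounds

end OrthPoly

/-! ### The Jacobi operator and bounds on its quadratic form -/

namespace OrthPoly

open scoped InnerProductSpace

variable {F : Type*} [NormedAddCommGroup F] [InnerProductSpace ℝ F]

/-- The vectors `b n` for which the Jacobi operator is the sum of the rank one operators
`f ↦ ⟪b n, f⟫ b n`. -/
noncomputable def jacobiVec (α γ : ℕ → ℝ) (e : HilbertBasis ℕ ℝ F) (n : ℕ) : F :=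
  √(γ n) • e n - √(α (n + 1)) • e (n + 1)

/-- The Jacobi operator. -/
noncomputable def jacobi (α γ : ℕ → ℝ) (e : HilbertBasis ℕ ℝ F) : F →L[ℝ] F :=
  ∑' n, InnerProductSpace.rankOne ℝ (jacobiVec α γ e n) (jacobiVec α γ e n)

theorem inner_basis (e : HilbertBasis ℕ ℝ F) (i j : ℕ) :
    ⟪e i, e j⟫_ℝ = if i = j then 1 else 0 :=
  orthonormal_iff_ite.1 e.orthonormal i j

theorem inner_jacobiVec (α γ : ℕ → ℝ) (e : HilbertBasis ℕ ℝ F) (n : ℕ) (f : F) :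
    ⟪jacobiVec α γ e n, f⟫_ℝ = √(γ n) * ⟪e n, f⟫_ℝ - √(α (n + 1)) * ⟪e (n + 1), f⟫_ℝ := by
  simp [jacobiVec, inner_sub_left, real_inner_smul_left]

theorem hasSum_sq_inner (e : HilbertBasis ℕ ℝ F) (f : F) :
    HasSum (fun n => ⟪e n, f⟫_ℝ ^ 2) (‖f‖ ^ 2) := by
  have := e.hasSum_inner_mul_inner f f
  rw [real_inner_self_eq_norm_sq] at this
  refine this.congr_fun fun n => ?_
  rw [real_inner_comm f]
  ring

namespace GeomBounds

variable {α γ : ℕ → ℝ} {q s B g m M : ℝ}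

theorem norm_sq_jacobiVec (hb : GeomBounds α γ q s B g m M) (e : HilbertBasis ℕ ℝ F) (n : ℕ) :
    ‖jacobiVec α γ e n‖ ^ 2 = γ n + α (n + 1) := by
  rw [← real_inner_self_eq_norm_sq, inner_jacobiVec]
  simp only [jacobiVec, inner_sub_right, real_inner_smul_right, inner_basis]
  simp
  rw [← pow_two, ← pow_two, Real.sq_sqrt (hb.gamma_pos n).le, Real.sq_sqrt (hb.alpha_pos n).le]

theorem norm_sq_jacobiVec_le (hb : GeomBounds α γ q s B g m M) (e : HilbertBasis ℕ ℝ F) (n : ℕ) :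
    ‖jacobiVec α γ e n‖ ^ 2 ≤ B * q ^ n :=
  (hb.norm_sq_jacobiVec e n).trans_le (hb.add_le n)

theorem abs_inner_mul_inner_le (hb : GeomBounds α γ q s B g m M) (e : HilbertBasis ℕ ℝ F)
    (f f' : F) (n : ℕ) : |⟪jacobiVec α γ e n, f⟫_ℝ * ⟪jacobiVec α γ e n, f'⟫_ℝ| ≤
      B * q ^ n * (‖f‖ * ‖f'‖) := by
  rw [abs_mul]
  calc _ ≤ (‖jacobiVec α γ e n‖ * ‖f‖) * (‖jacobiVec α γ e n‖ * ‖f'‖) :=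
        mul_le_mul (abs_real_inner_le_norm _ _) (abs_real_inner_le_norm _ _) (abs_nonneg _)
          (by positivity)
    _ = ‖jacobiVec α γ e n‖ ^ 2 * (‖f‖ * ‖f'‖) := by ring
    _ ≤ _ := by
        gcongr
        exact hb.norm_sq_jacobiVec_le e n

theorem summable_pow (hb : GeomBounds α γ q s B g m M) : Summable fun n => B * q ^ n :=
  (summable_geometric_of_lt_one hb.q_pos.le hb.q_lt_one).mul_left B

variable [CompleteSpace F]

theorem summable_rankOne (hb : GeomBounds α γ q s B g m M) (e : HilbertBasis ℕ ℝ F) :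
    Summable fun n => InnerProductSpace.rankOne ℝ (jacobiVec α γ e n) (jacobiVec α γ e n) := by
  refine Summable.of_norm_bounded hb.summable_pow fun n => ?_
  rw [InnerProductSpace.norm_rankOne, ← pow_two]
  exact hb.norm_sq_jacobiVec_le e n

theorem hasSum_inner_jacobi (hb : GeomBounds α γ q s B g m M) (e : HilbertBasis ℕ ℝ F) (f f' : F) :
    HasSum (fun n => ⟪jacobiVec α γ e n, f⟫_ℝ * ⟪jacobiVec α γ e n, f'⟫_ℝ)
      ⟪jacobi α γ e f, f'⟫_ℝ := by
  have h1 := (hb.summable_rankOne e).hasSum.mapL ((ContinuousLinearMap.apply ℝ F) f)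
  have h2 := h1.mapL (innerSL ℝ f')
  simp only [ContinuousLinearMap.apply_apply, innerSL_apply_apply,
    InnerProductSpace.rankOne_apply] at h2
  rw [real_inner_comm]
  refine h2.congr_fun fun n => ?_
  rw [real_inner_smul_right, real_inner_comm f']

theorem isSymmetric_jacobi (hb : GeomBounds α γ q s B g m M) (e : HilbertBasis ℕ ℝ F) :
    (jacobi α γ e).IsSymmetric := by
  intro f f'
  have h1 := hb.hasSum_inner_jacobi e f f'
  have h2 := hb.hasSum_inner_jacobi e f' f
  rw [real_inner_comm] at h2
  refine h1.unique (h2.congr_fun fun n => ?_)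
  ring

theorem isCompactOperator_jacobi (hb : GeomBounds α γ q s B g m M) (e : HilbertBasis ℕ ℝ F) :
    IsCompactOperator (jacobi α γ e) := by
  refine isCompactOperator_of_tendsto (hb.summable_rankOne e).hasSum
    (Eventually.of_forall fun t => ?_)
  refine Submodule.sum_mem (compactOperator (RingHom.id ℝ) F F) fun n _ => ?_
  change IsCompactOperator (InnerProductSpace.rankOne ℝ (jacobiVec α γ e n) (jacobiVec α γ e n))
  have h1 : IsCompactOperator (innerSL ℝ (jacobiVec α γ e n)) :=
    isCompactOperator_of_locallyCompactSpace_dom _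
  exact h1.clm_comp (ContinuousLinearMap.toSpanSingleton ℝ (jacobiVec α γ e n))

/-- Only the rank one terms with index at least `n - 1` see `f'`, and they sum geometrically. The
extra `1 / q` pays for the shift from n to `n - 1`, with truncated subtraction at n = 0. -/
theorem abs_inner_jacobi_le (hb : GeomBounds α γ q s B g m M) (e : HilbertBasis ℕ ℝ F) (f f' : F)
    (n : ℕ) (hf' : ∀ j < n, ⟪e j, f'⟫_ℝ = 0) :
    |⟪jacobi α γ e f, f'⟫_ℝ| ≤ B / (q * (1 - q)) * q ^ n * (‖f‖ * ‖f'‖) := by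
  have hq := hb.q_pos
  have hq1 : 0 < 1 - q := by linarith [hb.q_lt_one]
  have hB := hb.B_pos
  have h1 := hb.hasSum_inner_jacobi e f f'
  have h2 : HasSum (fun k => B * q ^ (k + (n - 1)) * (‖f‖ * ‖f'‖))
      (B * q ^ (n - 1) * (1 - q)⁻¹ * (‖f‖ * ‖f'‖)) := by
    have := ((hasSum_geometric_of_lt_one hq.le hb.q_lt_one).mul_left (B * q ^ (n - 1))).mul_right
      (‖f‖ * ‖f'‖)
    refine this.congr_fun fun k => ?_
    rw [pow_add]
    ring
  have h3 := (hasSum_nat_add_iff' (n - 1)).2 h1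
  rw [Finset.sum_eq_zero, sub_zero] at h3
  · have h4 : |⟪jacobi α γ e f, f'⟫_ℝ| ≤ B * q ^ (n - 1) * (1 - q)⁻¹ * (‖f‖ * ‖f'‖) := by
      have h5 := h3.summable.abs.hasSum
      have h6 := hasSum_le (fun k => hb.abs_inner_mul_inner_le e f f' (k + (n - 1))) h5 h2
      refine le_trans ?_ h6
      rw [← h3.tsum_eq]
      exact norm_tsum_le_tsum_norm h3.summable.norm
    refine h4.trans ?_
    refine mul_le_mul_of_nonneg_right ?_ (by positivity)
    have : q ^ (n - 1) ≤ q ^ n / q := by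
      rw [le_div_iff₀ hq, ← pow_succ]
      exact pow_le_pow_of_le_one hq.le hb.q_lt_one.le (by omega)
    calc B * q ^ (n - 1) * (1 - q)⁻¹ ≤ B * (q ^ n / q) * (1 - q)⁻¹ := by gcongr
      _ = _ := by field_simp
  · intro k hk
    have hk' := Finset.mem_range.1 hk
    rw [inner_jacobiVec α γ e k f', hf' k (by omega), hf' (k + 1) (by omega)]
    ring

theorem inner_jacobi_self_nonneg (hb : GeomBounds α γ q s B g m M) (e : HilbertBasis ℕ ℝ F)
    (f : F) : 0 ≤ ⟪jacobi α γ e f, f⟫_ℝ :=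
  (hb.hasSum_inner_jacobi e f f).nonneg fun _ => mul_self_nonneg _

-- In the coordinates `u n = ⟪e n, f⟫ / √(h n)` the quadratic form becomes the Dirichlet sum of `γ n
-- * h n * (u n - u (n+1))²`.
omit [CompleteSpace F] in
theorem inner_jacobiVec_eq (hb : GeomBounds α γ q s B g m M) (e : HilbertBasis ℕ ℝ F) (n : ℕ)
    (f : F) : ⟪jacobiVec α γ e n, f⟫_ℝ = √(γ n * h α γ n) *
      (⟪e n, f⟫_ℝ / √(h α γ n) - ⟪e (n + 1), f⟫_ℝ / √(h α γ (n + 1))) := by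
  have h0 := Real.sqrt_pos.2 (hb.h_pos n)
  have h1 := Real.sqrt_pos.2 (hb.h_pos (n + 1))
  rw [inner_jacobiVec, mul_sub]
  congr 1
  · rw [Real.sqrt_mul (hb.gamma_pos n).le]
    field_simp
  · rw [← alpha_mul_h_succ γ hb.alpha_pos n, Real.sqrt_mul (hb.alpha_pos n).le]
    field_simp

theorem isSolution_of_eigenvector (hb : GeomBounds α γ q s B g m M) (e : HilbertBasis ℕ ℝ F)
    {x : ℝ} {f : F} (hf : jacobi α γ e f = x • f) :
    IsSolution α γ x fun n => ⟪e n, f⟫_ℝ / √(h α γ n) := by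
  intro n
  have hs : ∀ j, √(h α γ j) ≠ 0 := fun j => (Real.sqrt_pos.2 (hb.h_pos j)).ne'
  -- In the rescaled coordinates G is the indicator of `{0, …, n}`, so only its jump at n
  -- contributes to the form.
  set G : F := ∑ j ∈ Finset.range (n + 1), √(h α γ j) • e j with hG
  have hGi : ∀ i, ⟪e i, G⟫_ℝ = if i < n + 1 then √(h α γ i) else 0 := by
    intro i
    simp [hG, inner_sum, real_inner_smul_right, inner_basis]
  have h1 := hb.hasSum_inner_jacobi e f G
  have h2 : ⟪jacobi α γ e f, G⟫_ℝ = ⟪jacobiVec α γ e n, f⟫_ℝ * ⟪jacobiVec α γ e n, G⟫_ℝ := by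
    refine h1.unique (hasSum_single n fun k hk => ?_)
    rw [hb.inner_jacobiVec_eq e k G, hGi, hGi]
    rcases lt_or_gt_of_ne hk with h | h
    · rw [if_pos (by omega), if_pos (by omega), div_self (hs _), div_self (hs _)]
      ring
    · rw [if_neg (by omega), if_neg (by omega)]
      ring
  have h3 : ⟪jacobi α γ e f, G⟫_ℝ =
      x * ∑ j ∈ Finset.range (n + 1), h α γ j * (⟪e j, f⟫_ℝ / √(h α γ j)) := by
    rw [hf, real_inner_smul_left, hG, inner_sum]
    congr 1
    refine Finset.sum_congr rfl fun j _ => ?_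
    rw [real_inner_smul_right, real_inner_comm]
    have h4 := Real.mul_self_sqrt (hb.h_pos j).le
    have h0 := hs j
    rw [mul_div_assoc', eq_div_iff h0]
    linear_combination ⟪e j, f⟫_ℝ * h4
  rw [← h3, h2, hb.inner_jacobiVec_eq e n f, hb.inner_jacobiVec_eq e n G, hGi, hGi,
    if_pos (by omega), if_neg (by omega), div_self (hs _)]
  have h4 := Real.mul_self_sqrt (mul_pos (hb.gamma_pos n) (hb.h_pos n)).le
  conv_lhs => rw [← h4]
  ring

/-- The rescaled coordinate at j telescopes up to n, where it vanishes; Cauchy–Schwarz with weights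
`γ k * h k` brings in the Dirichlet sum. -/
theorem sq_le_of_vanishing (hb : GeomBounds α γ q s B g m M) (e : HilbertBasis ℕ ℝ F) (f : F)
    {n : ℕ} (hf : ∀ j, n ≤ j → ⟪e j, f⟫_ℝ = 0) {j : ℕ} (hj : j ≤ n) :
    (⟪e j, f⟫_ℝ / √(h α γ j)) ^ 2 ≤
      (∑ k ∈ Finset.Ico j n, 1 / (γ k * h α γ k)) * ⟪jacobi α γ e f, f⟫_ℝ := by
  set u : ℕ → ℝ := fun j => ⟪e j, f⟫_ℝ / √(h α γ j) with hu
  have h1 : u j = ∑ k ∈ Finset.Ico j n, (u k - u (k + 1)) := by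
    have := Finset.sum_Ico_sub u hj
    have h2 : u n = 0 := by simp [hu, hf n le_rfl]
    rw [h2] at this
    have h3 : ∑ k ∈ Finset.Ico j n, (u k - u (k + 1)) =
      -∑ k ∈ Finset.Ico j n, (u (k + 1) - u k) := by
      rw [← Finset.sum_neg_distrib]
      exact Finset.sum_congr rfl fun _ _ => by ring
    rw [h3, this]
    ring
  have hp : ∀ k, 0 < γ k * h α γ k := fun k => mul_pos (hb.gamma_pos k) (hb.h_pos k)
  have h2 : ∑ k ∈ Finset.Ico j n, (γ k * h α γ k) * (u k - u (k + 1)) ^ 2 ≤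
      ⟪jacobi α γ e f, f⟫_ℝ := by
    refine (Finset.sum_le_sum fun k _ => ?_).trans
      (sum_le_hasSum (Finset.Ico j n) (fun k _ => mul_self_nonneg _)
        (hb.hasSum_inner_jacobi e f f))
    rw [hb.inner_jacobiVec_eq e k f, mul_mul_mul_comm, Real.mul_self_sqrt (hp k).le, ← pow_two]
  have h3 := Finset.sum_sq_le_sum_mul_sum_of_sq_le_mul (Finset.Ico j n)
    (r := fun k => u k - u (k + 1)) (f := fun k => 1 / (γ k * h α γ k))
    (g := fun k => (γ k * h α γ k) * (u k - u (k + 1)) ^ 2)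
    (fun k _ => (one_div_pos.2 (hp k)).le) (fun k _ => by have := hp k; positivity)
    (fun k _ => by rw [← mul_assoc, one_div_mul_cancel (hp k).ne', one_mul])
  change u j ^ 2 ≤ _
  rw [h1]
  refine h3.trans ?_
  gcongr
  exact Finset.sum_nonneg fun k _ => (one_div_pos.2 (hp k)).le

/-- A discrete Hardy inequality: the pointwise bounds are summed against `h j`, the order of
summation is exchanged, and `sum_h_le` makes the outer sum telescope. -/
theorem norm_sq_le_inner_jacobi (hb : GeomBounds α γ q s B g m M) (e : HilbertBasis ℕ ℝ F)
    (f : F) {n : ℕ} (hf : ∀ j, n ≤ j → ⟪e j, f⟫_ℝ = 0) :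
    q ^ n * ‖f‖ ^ 2 ≤ growthRate q s g m M * ⟪jacobi α γ e f, f⟫_ℝ := by
  set Q := ⟪jacobi α γ e f, f⟫_ℝ with hQ
  have hQ0 : 0 ≤ Q := hb.inner_jacobi_self_nonneg e f
  have hp : ∀ k, 0 < γ k * h α γ k := fun k => mul_pos (hb.gamma_pos k) (hb.h_pos k)
  have h1 : ‖f‖ ^ 2 = ∑ j ∈ Finset.range n, ⟪e j, f⟫_ℝ ^ 2 := by
    refine (hasSum_sq_inner e f).unique (hasSum_sum_of_ne_finset_zero fun j hj => ?_)
    rw [hf j (by simpa using hj)]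
    ring
  have h2 : ‖f‖ ^ 2 ≤ ∑ j ∈ Finset.range n, ∑ k ∈ Finset.Ico j n,
      h α γ j * (1 / (γ k * h α γ k)) * Q := by
    rw [h1]
    refine Finset.sum_le_sum fun j hj => ?_
    have h3 := hb.sq_le_of_vanishing e f hf (Finset.mem_range.1 hj).le
    rw [div_pow, Real.sq_sqrt (hb.h_pos j).le, div_le_iff₀ (hb.h_pos j)] at h3
    refine h3.trans (le_of_eq ?_)
    rw [Finset.sum_mul, Finset.sum_mul]
    exact Finset.sum_congr rfl fun k _ => by ring
  have h3 : ∑ j ∈ Finset.range n, ∑ k ∈ Finset.Ico j n, h α γ j * (1 / (γ k * h α γ k)) * Q =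
      ∑ k ∈ Finset.range n, (∑ j ∈ Finset.range (k + 1), h α γ j) / (γ k * h α γ k) * Q := by
    rw [Finset.range_eq_Ico, Finset.sum_sigma', ]
    simp_rw [Finset.sum_div, Finset.sum_mul]
    rw [Finset.sum_sigma']
    refine Finset.sum_nbij' (fun p => ⟨p.2, p.1⟩) (fun p => ⟨p.2, p.1⟩) ?_ ?_ ?_ ?_ ?_
    · simp; intros; omega
    · simp; intros; omega
    · simp
    · simp
    · intro p _; simp only; ring
  have h4 : ∀ n, ∑ k ∈ Finset.range n,
      (∑ j ∈ Finset.range (k + 1), h α γ j) / (γ k * h α γ k) * Q ≤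
      growthRate q s g m M * (1 / q ^ n) * Q := by
    intro n
    calc _ ≤ ∑ k ∈ Finset.range n,
          growthRate q s g m M * (1 / q ^ (k + 1) - 1 / q ^ k) * Q := by
          refine Finset.sum_le_sum fun k _ => ?_
          gcongr
          rw [div_le_iff₀ (hp k)]
          exact hb.sum_h_le k
      _ = growthRate q s g m M * (1 / q ^ n - 1) * Q := by
          rw [← Finset.sum_mul, ← Finset.mul_sum, Finset.sum_range_sub (fun k => 1 / q ^ k)]
          simp
      _ ≤ _ := by
          have := hb.growthRate_pos
          gcongr
          linarith
  have h5 := h2.trans (h3.trans_le (h4 n))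
  have hqn : 0 < q ^ n := pow_pos hb.q_pos n
  calc q ^ n * ‖f‖ ^ 2 ≤ q ^ n * (growthRate q s g m M * (1 / q ^ n) * Q) := by gcongr
    _ = _ := by field_simp

end GeomBounds

end OrthPoly

/-! ### Eigenvalues and the complete system of eigenvectors -/

namespace OrthPoly

open scoped InnerProductSpace

theorem exists_strictAnti_range_eq {E : Set ℝ} (hpos : ∀ x ∈ E, 0 < x) (hinf : E.Infinite)
    (hfin : ∀ ε, 0 < ε → (E ∩ Set.Ici ε).Finite) :
    ∃ ξ : ℕ → ℝ, StrictAnti ξ ∧ Set.range ξ = E := by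
  -- The largest element of E below y. Positivity of y is assumed inside the existential so that
  -- `choose` gives a total function to iterate.
  have next : ∀ y : ℝ, ∃ z, 0 < y → z ∈ E ∧ z < y ∧ ∀ x ∈ E, x < y → x ≤ z := by
    intro y
    by_cases hy : 0 < y
    · obtain ⟨d, hdE, hdy⟩ : ∃ d ∈ E, d < y := by
        by_contra hne
        push Not at hne
        exact hinf ((hfin y hy).subset fun x hx => ⟨hx, hne x hx⟩)
      have hf : ((E ∩ Set.Ici d) ∩ Set.Iio y).Finite := (hfin d (hpos d hdE)).inter_of_left _
      obtain ⟨z, hz, hmax⟩ := Set.exists_max_image _ id hf ⟨d, ⟨hdE, Set.self_mem_Ici⟩, hdy⟩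
      refine ⟨z, fun _ => ⟨hz.1.1, hz.2, fun x hx hxy => ?_⟩⟩
      rcases le_total d x with h | h
      · exact hmax x ⟨⟨hx, h⟩, hxy⟩
      · exact h.trans hz.1.2
    · exact ⟨0, fun h => absurd h hy⟩
  choose nx hnx using next
  obtain ⟨Y, hY0, hY⟩ : ∃ Y : ℝ, 0 < Y ∧ ∀ x ∈ E, x < Y := by
    obtain ⟨b, hb⟩ := (hfin 1 one_pos).bddAbove
    refine ⟨max b 1 + 1, by positivity, fun x hx => ?_⟩
    rcases le_total 1 x with h | h
    · linarith [hb ⟨hx, h⟩, le_max_left b 1]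
    · linarith [le_max_right b 1]
  let ξ : ℕ → ℝ := fun n => nx^[n] (nx Y)
  have hξs : ∀ n, ξ (n + 1) = nx (ξ n) := fun n => Function.iterate_succ_apply' nx n _
  have hmem : ∀ n, ξ n ∈ E := by
    intro n
    induction n with
    | zero => exact (hnx Y hY0).1
    | succ n ih => rw [hξs]; exact (hnx _ (hpos _ ih)).1
  have hanti : StrictAnti ξ := strictAnti_nat_of_succ_lt fun n => by
    rw [hξs]; exact (hnx _ (hpos _ (hmem n))).2.1
  refine ⟨ξ, hanti, Set.Subset.antisymm (Set.range_subset_iff.2 hmem) fun x hx => ?_⟩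
  by_contra hne
  have hlt : ∀ n, x < ξ n := by
    intro n
    induction n with
    | zero =>
      exact lt_of_le_of_ne ((hnx Y hY0).2.2 x hx (hY x hx)) fun h => hne ⟨0, h.symm⟩
    | succ n ih =>
      refine lt_of_le_of_ne ?_ fun h => hne ⟨n + 1, h.symm⟩
      rw [hξs]
      exact (hnx _ (hpos _ (hmem n))).2.2 x hx ih
  -- A missed point x would lie below every `ξ n`, giving infinitely many elements of E above x > 0.
  refine Set.infinite_range_of_injective hanti.injective ((hfin x (hpos x hx)).subset ?_)
  rintro _ ⟨n, rfl⟩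
  exact ⟨hmem n, (hlt n).le⟩

variable {F : Type*} [NormedAddCommGroup F] [InnerProductSpace ℝ F]

theorem exists_combination_vanishing {n : ℕ} (l : Fin n → Fin (n + 1) → ℝ) :
    ∃ c : Fin (n + 1) → ℝ, c ≠ 0 ∧ ∀ j, ∑ i, c i * l j i = 0 := by
  let L : (Fin (n + 1) → ℝ) →ₗ[ℝ] (Fin n → ℝ) :=
    LinearMap.pi fun j => ∑ i, (l j i) • LinearMap.proj i
  have hL : LinearMap.ker L ≠ ⊥ := LinearMap.ker_ne_bot_of_finrank_lt (by simp)
  obtain ⟨c, hc, hc0⟩ := Submodule.exists_mem_ne_zero_of_ne_bot hL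
  refine ⟨c, hc0, fun j => ?_⟩
  have := congrFun (LinearMap.mem_ker.1 hc) j
  simp only [L, LinearMap.pi_apply, LinearMap.sum_apply, LinearMap.smul_apply, LinearMap.proj_apply,
    smul_eq_mul, Pi.zero_apply] at this
  rw [← this]
  exact Finset.sum_congr rfl fun i _ => mul_comm _ _

theorem inner_eq_zero_of_eigenvectors {T : F →L[ℝ] F} (hT : T.IsSymmetric) {x y : ℝ} (hxy : x ≠ y)
    {f g : F} (hf : T f = x • f) (hg : T g = y • g) : ⟪f, g⟫_ℝ = 0 := by
  have h1 : ⟪T f, g⟫_ℝ = ⟪f, T g⟫_ℝ := hT f g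
  rw [hf, hg, real_inner_smul_left, real_inner_smul_right] at h1
  have h2 : (x - y) * ⟪f, g⟫_ℝ = 0 := by linarith
  exact (mul_eq_zero.1 h2).resolve_left (sub_ne_zero.2 hxy)

theorem norm_sq_sum_of_orthogonal {ι : Type*} [Fintype ι] (w : ι → F) (c x : ι → ℝ)
    (hw : Pairwise fun i j => ⟪w i, w j⟫_ℝ = 0) :
    ⟪∑ i, (c i * x i) • w i, ∑ i, c i • w i⟫_ℝ = ∑ i, x i * (c i ^ 2 * ‖w i‖ ^ 2) := by
  rw [sum_inner]
  refine Finset.sum_congr rfl fun i _ => ?_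
  rw [inner_sum, Finset.sum_eq_single i]
  · rw [real_inner_smul_left, real_inner_smul_right, real_inner_self_eq_norm_sq]
    ring
  · intro j _ hj
    rw [real_inner_smul_left, real_inner_smul_right, hw hj.symm]
    ring
  · simp

/-- A system of eigenvectors of the Jacobi operator, ordered by decreasing eigenvalues, whose
coordinates are given by the solutions `p x` of the recurrence. -/
structure IsEigenSystem (α γ : ℕ → ℝ) (e : HilbertBasis ℕ ℝ F) (p : ℝ → ℕ → ℝ) (ξ : ℕ → ℝ)
    (w : ℕ → F) : Prop where
  anti : StrictAnti ξ
  pos : ∀ k, 0 < ξ k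
  apply_eq : ∀ k, jacobi α γ e (w k) = ξ k • w k
  inner_eq : ∀ k n, ⟪e n, w k⟫_ℝ = √(h α γ n) * p (ξ k) n
  complete : ∀ f : F, (∀ k, ⟪w k, f⟫_ℝ = 0) → f = 0

theorem basis_ext (e : HilbertBasis ℕ ℝ F) {f g : F} (hfg : ∀ n, ⟪e n, f⟫_ℝ = ⟪e n, g⟫_ℝ) :
    f = g := by
  refine e.repr.injective (lp.ext (funext fun n => ?_))
  rw [e.repr_apply_apply, e.repr_apply_apply, hfg]

namespace GeomBounds

variable {α γ : ℕ → ℝ} {q s B g m M : ℝ} [CompleteSpace F]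

/-- For the eigenvalue 0 the rescaled coordinates are constant, so the squared coordinates are that
constant squared times `h n ≥ m`; square summability forces the constant to be 0. -/
theorem eigenvalue_pos (hb : GeomBounds α γ q s B g m M) (e : HilbertBasis ℕ ℝ F) {x : ℝ} {f : F}
    (hf0 : f ≠ 0) (hf : jacobi α γ e f = x • f) : 0 < x := by
  have hn : 0 < ‖f‖ ^ 2 := by positivity
  have h1 := hb.inner_jacobi_self_nonneg e f
  rw [hf, real_inner_smul_left, real_inner_self_eq_norm_sq] at h1
  refine lt_of_le_of_ne (nonneg_of_mul_nonneg_left h1 hn) fun hx => hf0 ?_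
  have hs := hb.isSolution_of_eigenvector e hf
  set u : ℕ → ℝ := fun n => ⟪e n, f⟫_ℝ / √(h α γ n) with hu
  have hconst : ∀ n, u n = u 0 := by
    intro n
    induction n with
    | zero => rfl
    | succ n ih =>
      have h2 := hs n
      rw [← hx, zero_mul] at h2
      have h3 := (mul_eq_zero.1 h2).resolve_left (mul_pos (hb.gamma_pos n) (hb.h_pos n)).ne'
      rw [← ih]
      linarith
  have hcoord : ∀ n, ⟪e n, f⟫_ℝ = √(h α γ n) * u 0 := by
    intro n
    have h0 := (Real.sqrt_pos.2 (hb.h_pos n)).ne'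
    rw [← hconst n, hu]
    field_simp
  have hu0 : u 0 = 0 := by
    have h2 := (hasSum_sq_inner e f).summable.tendsto_atTop_zero
    have h3 : m * u 0 ^ 2 ≤ 0 := by
      refine ge_of_tendsto' h2 fun n => ?_
      rw [hcoord, mul_pow, Real.sq_sqrt (hb.h_pos n).le]
      have h4 := hb.le_h n
      have h5 := one_le_pow₀ hb.one_lt_s.le (n := n)
      have h6 := hb.m_pos
      gcongr
      nlinarith
    have h4 := hb.m_pos
    have h5 : u 0 ^ 2 ≤ 0 := by
      by_contra h
      push Not at h
      nlinarith [mul_pos h4 h]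
    exact pow_eq_zero_iff two_ne_zero |>.1 (le_antisymm h5 (sq_nonneg _))
  refine basis_ext e fun n => ?_
  rw [hcoord, hu0]
  simp

theorem eigenvector_eq (hb : GeomBounds α γ q s B g m M) (e : HilbertBasis ℕ ℝ F) {x : ℝ} {f : F}
    {v : ℕ → ℝ} (hv : IsSolution α γ x v) (hv0 : v 0 = 1)
    (hf : jacobi α γ e f = x • f) (n : ℕ) : ⟪e n, f⟫_ℝ = ⟪e 0, f⟫_ℝ * (√(h α γ n) * v n) := by
  have h1 := (hb.isSolution_of_eigenvector e hf).eq_mul hb.alpha_pos hb.gamma_pos hv hv0 n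
  have h2 := (Real.sqrt_pos.2 (hb.h_pos n)).ne'
  simp only [h_zero, Real.sqrt_one, div_one] at h1
  rw [div_eq_iff h2] at h1
  rw [h1]
  ring

theorem exists_normalized_eigenvector (hb : GeomBounds α γ q s B g m M) (e : HilbertBasis ℕ ℝ F)
    {x : ℝ} {f : F} {v : ℕ → ℝ} (hv : IsSolution α γ x v) (hv0 : v 0 = 1) (hf0 : f ≠ 0)
    (hf : jacobi α γ e f = x • f) :
    ∃ w : F, jacobi α γ e w = x • w ∧ ∀ n, ⟪e n, w⟫_ℝ = √(h α γ n) * v n := by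
  have h0 : ⟪e 0, f⟫_ℝ ≠ 0 := fun h => hf0 <| basis_ext e fun n => by
    rw [hb.eigenvector_eq e hv hv0 hf, h]
    simp
  refine ⟨(⟪e 0, f⟫_ℝ)⁻¹ • f, ?_, fun n => ?_⟩
  · rw [map_smul, hf, smul_comm]
  · rw [real_inner_smul_right, hb.eigenvector_eq e hv hv0 hf n]
    field_simp

/-- The upper half of min-max: some nonzero combination of the `n + 1` eigenvectors has its first n
coordinates equal to 0, where the form is `O(q^n)`. -/
theorem le_of_orthogonal_eigenvectors (hb : GeomBounds α γ q s B g m M) (e : HilbertBasis ℕ ℝ F)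
    {n : ℕ} {x : Fin (n + 1) → ℝ} {w : Fin (n + 1) → F} (hw0 : ∀ i, w i ≠ 0)
    (hw : ∀ i, jacobi α γ e (w i) = x i • w i) (horth : Pairwise fun i j => ⟪w i, w j⟫_ℝ = 0)
    {ε : ℝ} (hε : ∀ i, ε ≤ x i) : ε ≤ B / (q * (1 - q)) * q ^ n := by
  obtain ⟨c, hc0, hc⟩ := exists_combination_vanishing (n := n) fun j i => ⟪e (j : ℕ), w i⟫_ℝ
  set u := ∑ i, c i • w i with hu
  have h1 := hb.abs_inner_jacobi_le e u u n fun j hj => by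
    have := hc ⟨j, hj⟩
    simpa [hu, inner_sum, real_inner_smul_right] using this
  have h2 : jacobi α γ e u = ∑ i, (c i * x i) • w i := by
    rw [hu, map_sum]
    exact Finset.sum_congr rfl fun i _ => by rw [map_smul, hw, smul_smul]
  have h3 : ‖u‖ ^ 2 = ∑ i, c i ^ 2 * ‖w i‖ ^ 2 := by
    have := norm_sq_sum_of_orthogonal w c (fun _ => 1) horth
    simpa [← hu] using this
  have h4 : ε * ‖u‖ ^ 2 ≤ ⟪jacobi α γ e u, u⟫_ℝ := by
    rw [h2, hu, norm_sq_sum_of_orthogonal w c x horth, ← hu, h3, Finset.mul_sum]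
    exact Finset.sum_le_sum fun i _ => mul_le_mul_of_nonneg_right (hε i) (by positivity)
  have h5 : 0 < ‖u‖ ^ 2 := by
    obtain ⟨i, hi⟩ := Function.ne_iff.1 hc0
    rw [h3]
    have hi' : c i ≠ 0 := hi
    have := hw0 i
    exact Finset.sum_pos' (fun _ _ => by positivity) ⟨i, Finset.mem_univ i, by positivity⟩
  refine le_of_mul_le_mul_right ?_ h5
  calc _ ≤ _ := h4
    _ ≤ _ := le_abs_self _
    _ ≤ _ := h1
    _ = _ := by ring

-- A dimension count in the span of `e 0, …, e n`. It serves both the lower half of min-max and the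
-- proof that there are infinitely many eigenvalues.
omit [CompleteSpace F] in
theorem exists_supported_orthogonal (e : HilbertBasis ℕ ℝ F) {n : ℕ} (w : Fin n → F) :
    ∃ f : F, f ≠ 0 ∧ (∀ j, n + 1 ≤ j → ⟪e j, f⟫_ℝ = 0) ∧ ∀ i, ⟪w i, f⟫_ℝ = 0 := by
  obtain ⟨c, hc0, hc⟩ := exists_combination_vanishing (n := n) fun j i => ⟪w j, e (i : ℕ)⟫_ℝ
  refine ⟨∑ i, c i • e (i : ℕ), fun hf => hc0 ?_, fun j hj => ?_, fun i => ?_⟩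
  · funext i
    have := congrArg (fun f => ⟪e (i : ℕ), f⟫_ℝ) hf
    simpa [inner_sum, real_inner_smul_right, inner_basis, Fin.val_inj] using this
  · rw [inner_sum]
    refine Finset.sum_eq_zero fun i _ => ?_
    rw [real_inner_smul_right, inner_basis, if_neg (by omega), mul_zero]
  · rw [inner_sum, ← hc i]
    exact Finset.sum_congr rfl fun i _ => real_inner_smul_right _ _ _

theorem exists_isEigenSystem (hb : GeomBounds α γ q s B g m M) (e : HilbertBasis ℕ ℝ F)
    {p : ℝ → ℕ → ℝ} (hp : ∀ x, IsSolution α γ x (p x)) (hp0 : ∀ x, p x 0 = 1) :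
    ∃ (ξ : ℕ → ℝ) (w : ℕ → F), IsEigenSystem α γ e p ξ w := by
  set E : Set ℝ := {x | ∃ f, f ≠ 0 ∧ jacobi α γ e f = x • f} with hE
  have hT := hb.isSymmetric_jacobi e
  have hpos : ∀ x ∈ E, 0 < x := fun x ⟨f, hf0, hf⟩ => hb.eigenvalue_pos e hf0 hf
  have hex : ∀ x, ∃ w : F, x ∈ E →
      jacobi α γ e w = x • w ∧ ∀ n, ⟪e n, w⟫_ℝ = √(h α γ n) * p x n := by
    intro x
    by_cases hx : x ∈ E
    · obtain ⟨f, hf0, hf⟩ := hx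
      obtain ⟨w, hw⟩ := hb.exists_normalized_eigenvector e (hp x) (hp0 x) hf0 hf
      exact ⟨w, fun _ => hw⟩
    · exact ⟨0, fun h => absurd h hx⟩
  choose w hw using hex
  have hw0 : ∀ x ∈ E, w x ≠ 0 := by
    intro x hx h0
    have := (hw x hx).2 0
    rw [h0, hp0, h_zero] at this
    simp at this
  have hcomplete : ∀ f : F, (∀ x ∈ E, ⟪w x, f⟫_ℝ = 0) → f = 0 := by
    intro f hf
    have h1 := ContinuousLinearMap.orthogonalComplement_iSup_eigenspaces_eq_bot
      (hb.isCompactOperator_jacobi e) hT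
    have h2 : f ∈ (⨆ μ, Module.End.eigenspace (jacobi α γ e : Module.End ℝ F) μ)ᗮ := by
      rw [← Submodule.iInf_orthogonal, Submodule.mem_iInf]
      intro x
      rw [Submodule.mem_orthogonal]
      intro v hv
      have hv' : jacobi α γ e v = x • v := Module.End.mem_eigenspace_iff.1 hv
      rcases eq_or_ne v 0 with rfl | hv0
      · simp
      have hx : x ∈ E := ⟨v, hv0, hv'⟩
      -- By simplicity every eigenvector is a multiple of the normalized one, so orthogonality to `w
      -- x` gives orthogonality to the whole eigenspace.
      have h3 : v = ⟪e 0, v⟫_ℝ • w x := basis_ext e fun n => by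
        rw [real_inner_smul_right, (hw x hx).2 n, hb.eigenvector_eq e (hp x) (hp0 x) hv' n]
      rw [h3, real_inner_smul_left, hf x hx, mul_zero]
    rw [h1] at h2
    exact (Submodule.mem_bot ℝ).1 h2
  have horth : ∀ x ∈ E, ∀ y ∈ E, x ≠ y → ⟪w x, w y⟫_ℝ = 0 := fun x hx y hy hxy =>
    inner_eq_zero_of_eigenvectors hT hxy (hw x hx).1 (hw y hy).1
  have hfin : ∀ ε, 0 < ε → (E ∩ Set.Ici ε).Finite := by
    intro ε hε
    by_contra hinf
    have hq := hb.q_pos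
    have hlim : Tendsto (fun n : ℕ => B / (q * (1 - q)) * q ^ n) atTop (𝓝 0) := by
      simpa using (tendsto_pow_atTop_nhds_zero_of_lt_one hq.le hb.q_lt_one).const_mul _
    obtain ⟨n, hn⟩ := (hlim.eventually (gt_mem_nhds hε)).exists
    obtain ⟨t, htE, htc⟩ := Set.Infinite.exists_subset_card_eq hinf (n + 1)
    let x : Fin (n + 1) → ℝ := fun i => t.orderEmbOfFin htc i
    have hx : ∀ i, x i ∈ E ∩ Set.Ici ε := fun i => htE (t.orderEmbOfFin_mem htc i)
    have hxi : Function.Injective x := (t.orderEmbOfFin htc).injective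
    have := hb.le_of_orthogonal_eigenvectors e (x := x) (w := fun i => w (x i))
      (fun i => hw0 _ (hx i).1) (fun i => (hw _ (hx i).1).1)
      (fun i j hij => horth _ (hx i).1 _ (hx j).1 (hxi.ne hij)) (fun i => (hx i).2)
    linarith
  have hinf : E.Infinite := by
    intro hE
    obtain ⟨f, hf0, -, hf⟩ := exists_supported_orthogonal e
      (fun i : Fin hE.toFinset.card => w (hE.toFinset.orderEmbOfFin rfl i))
    refine hf0 (hcomplete f fun x hx => ?_)
    have hx' : x ∈ Set.range (hE.toFinset.orderEmbOfFin rfl) := by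
      rw [Finset.range_orderEmbOfFin]
      simpa using hx
    obtain ⟨i, rfl⟩ := hx'
    exact hf i
  obtain ⟨ξ, hanti, hrange⟩ := exists_strictAnti_range_eq hpos hinf hfin
  have hmem : ∀ k, ξ k ∈ E := fun k => hrange ▸ Set.mem_range_self k
  refine ⟨ξ, fun k => w (ξ k), hanti, fun k => hpos _ (hmem k), fun k => (hw _ (hmem k)).1,
    fun k n => (hw _ (hmem k)).2 n, fun f hf => hcomplete f fun x hx => ?_⟩
  rw [← hrange] at hx
  obtain ⟨k, rfl⟩ := hx
  exact hf k

end GeomBounds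

end OrthPoly

/-! ### Asymptotics of eigenvalues and eigenvector norms, and separation -/

namespace OrthPoly

open scoped InnerProductSpace

variable {F : Type*} [NormedAddCommGroup F] [InnerProductSpace ℝ F]

/-- The truncation of a vector to its first `n` coordinates. -/
noncomputable def head (e : HilbertBasis ℕ ℝ F) (n : ℕ) (f : F) : F :=
  ∑ j ∈ Finset.range n, ⟪e j, f⟫_ℝ • e j

theorem inner_basis_head (e : HilbertBasis ℕ ℝ F) (n : ℕ) (f : F) (i : ℕ) :
    ⟪e i, head e n f⟫_ℝ = if i < n then ⟪e i, f⟫_ℝ else 0 := by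
  simp [head, inner_sum, real_inner_smul_right, inner_basis]

theorem inner_head_left (e : HilbertBasis ℕ ℝ F) (n : ℕ) (f g : F) :
    ⟪head e n f, g⟫_ℝ = ∑ j ∈ Finset.range n, ⟪e j, f⟫_ℝ * ⟪e j, g⟫_ℝ := by
  simp [head, sum_inner, real_inner_smul_left]

theorem inner_head_head (e : HilbertBasis ℕ ℝ F) (n : ℕ) (f g : F) :
    ⟪head e n f, head e n g⟫_ℝ = ⟪head e n f, g⟫_ℝ := by
  rw [inner_head_left, inner_head_left]
  refine Finset.sum_congr rfl fun j hj => ?_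
  rw [inner_basis_head, if_pos (Finset.mem_range.1 hj)]

theorem inner_eq_head_add_tail (e : HilbertBasis ℕ ℝ F) (n : ℕ) (f g : F) :
    ⟪f, g⟫_ℝ = ⟪head e n f, head e n g⟫_ℝ + ⟪f - head e n f, g - head e n g⟫_ℝ := by
  have h1 := inner_head_head e n f g
  have h2 : ⟪f, head e n g⟫_ℝ = ⟪head e n f, head e n g⟫_ℝ := by
    rw [real_inner_comm, ← inner_head_head, real_inner_comm]
  rw [inner_sub_left, inner_sub_right, inner_sub_right, h2, h1]
  ring

theorem norm_sq_head (e : HilbertBasis ℕ ℝ F) (n : ℕ) (f : F) :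
    ‖head e n f‖ ^ 2 = ∑ j ∈ Finset.range n, ⟪e j, f⟫_ℝ ^ 2 := by
  rw [← real_inner_self_eq_norm_sq, inner_head_head, inner_head_left]
  exact Finset.sum_congr rfl fun j _ => (pow_two _).symm

theorem norm_sq_eq_head_add_tail (e : HilbertBasis ℕ ℝ F) (n : ℕ) (f : F) :
    ‖f‖ ^ 2 = ‖head e n f‖ ^ 2 + ‖f - head e n f‖ ^ 2 := by
  simp only [← real_inner_self_eq_norm_sq]
  exact inner_eq_head_add_tail e n f f

theorem head_sub (e : HilbertBasis ℕ ℝ F) (n : ℕ) (f g : F) :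
    head e n (f - g) = head e n f - head e n g := by
  simp [head, inner_sub_right, sub_smul]

theorem sq_inner_basis_le (e : HilbertBasis ℕ ℝ F) (f : F) (n : ℕ) :
    ⟪e n, f⟫_ℝ ^ 2 ≤ ‖f‖ ^ 2 :=
  le_hasSum (hasSum_sq_inner e f) n fun _ _ => sq_nonneg _

/-- Orthogonal vectors with small tails have well separated heads. -/
theorem norm_sq_le_of_orthogonal (e : HilbertBasis ℕ ℝ F) (n : ℕ) {f g : F} (hfg : ⟪f, g⟫_ℝ = 0)
    (hf : ‖f - head e n f‖ ≤ 1 / 2 * ‖f‖) (hg : ‖g - head e n g‖ ≤ 1 / 2 * ‖g‖) :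
    2 / 3 * ‖f‖ ^ 2 ≤ ‖head e n (f - g)‖ ^ 2 := by
  have h1 := inner_eq_head_add_tail e n f g
  have h2 := norm_sq_eq_head_add_tail e n f
  have h3 := norm_sq_eq_head_add_tail e n g
  have h4 : ‖head e n (f - g)‖ ^ 2 =
      ‖head e n f‖ ^ 2 - 2 * ⟪head e n f, head e n g⟫_ℝ + ‖head e n g‖ ^ 2 := by
    rw [head_sub]
    exact norm_sub_sq_real _ _
  have h5 := abs_real_inner_le_norm (f - head e n f) (g - head e n g)
  set a := ‖head e n f‖
  set b := ‖head e n g‖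
  set a' := ‖f - head e n f‖
  set b' := ‖g - head e n g‖
  have ha : 0 ≤ a := norm_nonneg _
  have hb : 0 ≤ b := norm_nonneg _
  have ha' : 0 ≤ a' := norm_nonneg _
  have hb' : 0 ≤ b' := norm_nonneg _
  have h6 : 3 * a' ^ 2 ≤ a ^ 2 := by nlinarith [norm_nonneg f]
  have h7 : 3 * b' ^ 2 ≤ b ^ 2 := by nlinarith [norm_nonneg g]
  have h8 : 3 * (a' * b') ≤ a * b := by
    refine abs_le_of_sq_le_sq' ?_ (by positivity) |>.2
    calc (3 * (a' * b')) ^ 2 = (3 * a' ^ 2) * (3 * b' ^ 2) := by ring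
      _ ≤ a ^ 2 * b ^ 2 := by gcongr
      _ = _ := by ring
  have h9 : ⟪head e n f, head e n g⟫_ℝ ≤ a' * b' := by
    have := (abs_le.1 h5).1
    linarith
  rw [h4, h2]
  -- As `‖f‖² ≤ 4a²/3` and the inner product of the heads is at most `ab/3`, it suffices that `a² -
  -- 2ab/3 + b² ≥ 8a²/9`; the difference is `(a/3 - b)²`.
  nlinarith [sq_nonneg (a / 3 - b)]

variable {α γ : ℕ → ℝ} {q s B g m M : ℝ} [CompleteSpace F] {e : HilbertBasis ℕ ℝ F}
  {p : ℝ → ℕ → ℝ} {ξ : ℕ → ℝ} {w : ℕ → F}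

namespace IsEigenSystem

omit [CompleteSpace F] in
theorem ne_zero (hw : IsEigenSystem α γ e p ξ w) (hp0 : ∀ x, p x 0 = 1) (k : ℕ) : w k ≠ 0 := by
  intro h0
  have := hw.inner_eq k 0
  rw [h0, hp0, h_zero] at this
  simp at this

theorem orthogonal (hw : IsEigenSystem α γ e p ξ w) (hb : GeomBounds α γ q s B g m M) {i j : ℕ}
    (hij : i ≠ j) : ⟪w i, w j⟫_ℝ = 0 :=
  inner_eq_zero_of_eigenvectors (hb.isSymmetric_jacobi e) (hw.anti.injective.ne hij)
    (hw.apply_eq i) (hw.apply_eq j)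

/-- Parseval's identity in the normalized eigenbasis. Applied to basis vectors it yields the total
mass and the orthogonality relations. -/
theorem hasSum_inner_mul_inner (hw : IsEigenSystem α γ e p ξ w)
    (hb : GeomBounds α γ q s B g m M) (hp0 : ∀ x, p x 0 = 1) (f f' : F) :
    HasSum (fun k => 1 / ‖w k‖ ^ 2 * (⟪w k, f⟫_ℝ * ⟪w k, f'⟫_ℝ)) ⟪f, f'⟫_ℝ := by
  have hn : ∀ k, ‖w k‖ ≠ 0 := fun k => norm_ne_zero_iff.2 (hw.ne_zero hp0 k)
  set v : ℕ → F := fun k => ‖w k‖⁻¹ • w k with hv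
  have hon : Orthonormal ℝ v := by
    refine ⟨fun k => ?_, fun i j hij => ?_⟩
    · rw [hv, norm_smul, norm_inv, norm_norm, inv_mul_cancel₀ (hn k)]
    · simp only [hv]
      rw [real_inner_smul_left, real_inner_smul_right, hw.orthogonal hb hij]
      ring
  have hsp : (Submodule.span ℝ (Set.range v))ᗮ = ⊥ := by
    rw [Submodule.eq_bot_iff]
    intro f hf
    refine hw.complete f fun k => ?_
    have h1 := (Submodule.mem_orthogonal _ _).1 hf (v k)
      (Submodule.subset_span (Set.mem_range_self k))
    simp only [hv] at h1
    rw [real_inner_smul_left] at h1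
    exact (mul_eq_zero.1 h1).resolve_left (inv_ne_zero (hn k))
  have h2 := (HilbertBasis.mkOfOrthogonalEqBot hon hsp).hasSum_inner_mul_inner f f'
  refine h2.congr_fun fun k => ?_
  rw [HilbertBasis.coe_mkOfOrthogonalEqBot]
  simp only [hv]
  rw [real_inner_smul_left, real_inner_smul_right, real_inner_comm f]
  field_simp

theorem le_mul_pow (hw : IsEigenSystem α γ e p ξ w) (hb : GeomBounds α γ q s B g m M)
    (hp0 : ∀ x, p x 0 = 1) (k : ℕ) : ξ k ≤ B / (q * (1 - q)) * q ^ k :=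
  hb.le_of_orthogonal_eigenvectors e (x := fun i : Fin (k + 1) => ξ i) (w := fun i => w i)
    (fun i => hw.ne_zero hp0 i) (fun i => hw.apply_eq i)
    (fun _ _ hij => hw.orthogonal hb (Fin.val_injective.ne hij))
    fun i => hw.anti.antitone (Nat.lt_succ_iff.1 i.2)

theorem inner_jacobi_le (hw : IsEigenSystem α γ e p ξ w) (hb : GeomBounds α γ q s B g m M)
    (hp0 : ∀ x, p x 0 = 1) (k : ℕ) {f : F} (hf : ∀ i < k, ⟪w i, f⟫_ℝ = 0) :
    ⟪jacobi α γ e f, f⟫_ℝ ≤ ξ k * ‖f‖ ^ 2 := by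
  have h1 := hw.hasSum_inner_mul_inner hb hp0 (jacobi α γ e f) f
  have h2 := (hw.hasSum_inner_mul_inner hb hp0 f f).mul_left (ξ k)
  rw [real_inner_self_eq_norm_sq] at h2
  refine hasSum_le (fun i => ?_) h1 h2
  have h3 : ⟪w i, jacobi α γ e f⟫_ℝ = ξ i * ⟪w i, f⟫_ℝ := by
    have : ⟪jacobi α γ e (w i), f⟫_ℝ = ⟪w i, jacobi α γ e f⟫_ℝ := hb.isSymmetric_jacobi e (w i) f
    rw [← this, hw.apply_eq, real_inner_smul_left]
  rw [h3]
  rcases lt_or_ge i k with h | h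
  · simp [hf i h]
  · have h4 := hw.anti.antitone h
    calc _ = ξ i * (1 / ‖w i‖ ^ 2 * (⟪w i, f⟫_ℝ * ⟪w i, f⟫_ℝ)) := by ring
      _ ≤ _ := mul_le_mul_of_nonneg_right h4
        (mul_nonneg (by positivity) (mul_self_nonneg _))

/-- The lower half of min-max, tested on a vector with `k + 1` coordinates orthogonal to the first k
eigenvectors. -/
theorem pow_le (hw : IsEigenSystem α γ e p ξ w) (hb : GeomBounds α γ q s B g m M)
    (hp0 : ∀ x, p x 0 = 1) (k : ℕ) : q ^ (k + 1) ≤ growthRate q s g m M * ξ k := by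
  obtain ⟨f, hf0, hfs, hf⟩ := GeomBounds.exists_supported_orthogonal e fun i : Fin k => w i
  have h1 := hb.norm_sq_le_inner_jacobi e f hfs
  have h2 := hw.inner_jacobi_le hb hp0 k (f := f) fun i hi => hf ⟨i, hi⟩
  have h3 : 0 < ‖f‖ ^ 2 := by positivity
  refine le_of_mul_le_mul_right ?_ h3
  calc _ ≤ _ := h1
    _ ≤ growthRate q s g m M * (ξ k * ‖f‖ ^ 2) :=
      mul_le_mul_of_nonneg_left h2 hb.growthRate_pos.le
    _ = _ := by ring

/-- The eigenvector equation is paired with the tail t itself, using `⟪w k, t⟫ = ‖t‖²`. -/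
theorem mul_norm_tail_le (hw : IsEigenSystem α γ e p ξ w) (hb : GeomBounds α γ q s B g m M)
    (k n : ℕ) : ξ k * ‖w k - head e n (w k)‖ ≤ B / (q * (1 - q)) * q ^ n * ‖w k‖ := by
  set t := w k - head e n (w k) with ht
  have hq := hb.q_pos
  have hq1 : 0 < 1 - q := by linarith [hb.q_lt_one]
  have hB := hb.B_pos
  rcases eq_or_ne t 0 with h0 | h0
  · rw [h0, norm_zero, mul_zero]
    positivity
  have h1 := hb.abs_inner_jacobi_le e (w k) t n fun j hj => by
    rw [ht, inner_sub_right, inner_basis_head, if_pos hj, sub_self]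
  have h2 : ⟪w k, t⟫_ℝ = ‖t‖ ^ 2 := by
    have : ⟪head e n (w k), t⟫_ℝ = 0 := by
      rw [ht, inner_sub_right, inner_head_head, sub_self]
    rw [← real_inner_self_eq_norm_sq]
    nth_rw 2 [ht]
    rw [inner_sub_left, this, sub_zero]
  rw [hw.apply_eq, real_inner_smul_left, h2, abs_of_nonneg (mul_nonneg (hw.pos k).le (sq_nonneg _))]
    at h1
  have h3 : 0 < ‖t‖ := norm_pos_iff.2 h0
  refine le_of_mul_le_mul_right ?_ h3
  calc _ = ξ k * ‖t‖ ^ 2 := by ring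
    _ ≤ _ := h1
    _ = _ := by ring

theorem exists_tail_le (hw : IsEigenSystem α γ e p ξ w) (hb : GeomBounds α γ q s B g m M)
    (hp0 : ∀ x, p x 0 = 1) :
    ∃ K, ∀ k n, k + K ≤ n → ‖w k - head e n (w k)‖ ≤ 1 / 2 * ‖w k‖ := by
  have hq := hb.q_pos
  have hq1 : 0 < 1 - q := by linarith [hb.q_lt_one]
  have hB := hb.B_pos
  have hρ := hb.growthRate_pos
  have hlim : Tendsto (fun n : ℕ => growthRate q s g m M * (B / (q * (1 - q))) * q ^ n) atTop
      (𝓝 0) := by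
    simpa using (tendsto_pow_atTop_nhds_zero_of_lt_one hq.le hb.q_lt_one).const_mul _
  -- The target is `q / 2` rather than `1 / 2` because the lower bound for `ξ k` carries `q ^ (k +
  -- 1)`.
  obtain ⟨K, hK⟩ := (hlim.eventually (ge_mem_nhds (show (0 : ℝ) < q / 2 by positivity))).exists
  refine ⟨K, fun k n hn => ?_⟩
  set t := ‖w k - head e n (w k)‖
  have h1 := hw.mul_norm_tail_le hb k n
  have h2 := hw.pow_le hb hp0 k
  have h3 : q ^ n ≤ q ^ k * q ^ K := by
    rw [← pow_add]
    exact pow_le_pow_of_le_one hq.le hb.q_lt_one.le hn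
  have h4 : 0 < q ^ (k + 1) := by positivity
  refine le_of_mul_le_mul_left ?_ h4
  calc q ^ (k + 1) * t ≤ growthRate q s g m M * ξ k * t := by gcongr
    _ = growthRate q s g m M * (ξ k * t) := by ring
    _ ≤ growthRate q s g m M * (B / (q * (1 - q)) * (q ^ k * q ^ K) * ‖w k‖) := by
        refine mul_le_mul_of_nonneg_left (h1.trans ?_) hρ.le
        gcongr
    _ = growthRate q s g m M * (B / (q * (1 - q))) * q ^ K * (q ^ k * ‖w k‖) := by ring
    _ ≤ q / 2 * (q ^ k * ‖w k‖) := by gcongr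
    _ = _ := by rw [pow_succ]; ring

/-- Up to index `k + K` the Grönwall exponent `ξ k / q ^ j` is at most a constant times `q ^ k / q ^
(k + K)`, uniformly in k. -/
theorem abs_coord_le (hw : IsEigenSystem α γ e p ξ w) (hb : GeomBounds α γ q s B g m M)
    (hp : ∀ x, IsSolution α γ x (p x)) (hp0 : ∀ x, p x 0 = 1) {k K j : ℕ} (hj : j ≤ k + K) :
    |p (ξ k) j| ≤ Real.exp (growthRate q s g m M * (B / (q * (1 - q))) / q ^ K) := by
  have hq := hb.q_pos
  have hρ := hb.growthRate_pos
  refine (hb.solution_bound (hw.pos k).le (hp _) (hp0 _) j).1.trans (Real.exp_le_exp.2 ?_)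
  refine (hb.div_pow_mono (hw.pos k).le hj).trans ?_
  have h1 := hw.le_mul_pow hb hp0 k
  calc _ ≤ growthRate q s g m M * (B / (q * (1 - q)) * q ^ k) / q ^ (k + K) := by gcongr
    _ = _ := by
      rw [pow_add]
      field_simp

theorem sum_h_range_le (hb : GeomBounds α γ q s B g m M) (n : ℕ) :
    ∑ j ∈ Finset.range n, h α γ j ≤ M * (s / (s - 1)) * s ^ n :=
  (Finset.sum_le_sum_of_subset_of_nonneg (Finset.range_mono n.le_succ)
    fun j _ _ => (hb.h_pos j).le).trans (hb.sum_h_le_pow n)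

theorem exists_norm_sq_le (hw : IsEigenSystem α γ e p ξ w) (hb : GeomBounds α γ q s B g m M)
    (hp : ∀ x, IsSolution α γ x (p x)) (hp0 : ∀ x, p x 0 = 1) :
    ∃ C, 0 < C ∧ ∀ k, ‖w k‖ ^ 2 ≤ C * s ^ k := by
  obtain ⟨K, hK⟩ := hw.exists_tail_le hb hp0
  have hM := hb.M_pos
  have hs : 0 < s := by linarith [hb.one_lt_s]
  have hs1 : 0 < s - 1 := by linarith [hb.one_lt_s]
  set E := Real.exp (growthRate q s g m M * (B / (q * (1 - q))) / q ^ K) with hE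
  have hE0 : 0 < E := Real.exp_pos _
  -- The tail carries at most a quarter of `‖w k‖²`, hence the factor `4 / 3`.
  refine ⟨4 / 3 * (E ^ 2 * (M * (s / (s - 1)) * s ^ K)), by positivity, fun k => ?_⟩
  have h1 := norm_sq_eq_head_add_tail e (k + K) (w k)
  have h2 := hK k (k + K) le_rfl
  have h3 : ‖head e (k + K) (w k)‖ ^ 2 ≤ E ^ 2 * (M * (s / (s - 1)) * s ^ (k + K)) := by
    rw [norm_sq_head]
    calc _ ≤ ∑ j ∈ Finset.range (k + K), E ^ 2 * h α γ j := by
          refine Finset.sum_le_sum fun j hj => ?_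
          rw [hw.inner_eq, mul_pow, Real.sq_sqrt (hb.h_pos j).le, mul_comm, ← sq_abs]
          have := hw.abs_coord_le hb hp hp0 (k := k) (Finset.mem_range.1 hj).le
          have := hb.h_pos j
          gcongr
      _ ≤ _ := by
          rw [← Finset.mul_sum]
          gcongr
          exact sum_h_range_le hb _
  have h4 : ‖w k - head e (k + K) (w k)‖ ^ 2 ≤ (1 / 2 * ‖w k‖) ^ 2 := by gcongr
  have h5 : 4 / 3 * (E ^ 2 * (M * (s / (s - 1)) * s ^ K)) * s ^ k =
      4 / 3 * (E ^ 2 * (M * (s / (s - 1)) * s ^ (k + K))) := by rw [pow_add]; ring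
  rw [h5]
  nlinarith

/-- One coordinate suffices: at index `k - K` the polynomial value is at least `1 / 2`. For k < K
the zeroth coordinate, equal to 1, is used instead. -/
theorem exists_le_norm_sq (hw : IsEigenSystem α γ e p ξ w) (hb : GeomBounds α γ q s B g m M)
    (hp : ∀ x, IsSolution α γ x (p x)) (hp0 : ∀ x, p x 0 = 1) :
    ∃ c, 0 < c ∧ ∀ k, c * s ^ k ≤ ‖w k‖ ^ 2 := by
  have hq := hb.q_pos
  have hρ := hb.growthRate_pos
  have hm := hb.m_pos
  have hs : 0 < s := by linarith [hb.one_lt_s]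
  have hlim : Tendsto (fun n : ℕ => Real.exp (growthRate q s g m M * (B / (q * (1 - q))) * q ^ n) - 1)
      atTop (𝓝 0) := by
    have h1 : Tendsto (fun n : ℕ => growthRate q s g m M * (B / (q * (1 - q))) * q ^ n) atTop
        (𝓝 0) := by
      simpa using (tendsto_pow_atTop_nhds_zero_of_lt_one hq.le hb.q_lt_one).const_mul _
    simpa using (Real.continuous_exp.tendsto 0 |>.comp h1).sub_const 1
  obtain ⟨K, hK⟩ := (hlim.eventually (ge_mem_nhds (show (0 : ℝ) < 1 / 2 by norm_num))).exists
  refine ⟨m / (4 * s ^ K), by positivity, fun k => ?_⟩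
  rcases lt_or_ge k K with hkK | hkK
  · have h1 := sq_inner_basis_le e (w k) 0
    rw [hw.inner_eq, hp0, h_zero] at h1
    simp only [Real.sqrt_one, mul_one, one_pow] at h1
    refine le_trans ?_ h1
    rw [div_mul_eq_mul_div, div_le_one (by positivity)]
    have h2 : s ^ k ≤ s ^ K := pow_le_pow_right₀ hb.one_lt_s.le hkK.le
    have h3 := hb.m_le_one
    calc m * s ^ k ≤ 1 * s ^ K := by gcongr
      _ ≤ _ := by linarith [pow_pos hs K]
  · obtain ⟨n, rfl⟩ := Nat.exists_eq_add_of_le' hkK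
    have h1 := sq_inner_basis_le e (w (n + K)) n
    rw [hw.inner_eq, mul_pow, Real.sq_sqrt (hb.h_pos n).le] at h1
    have h2 := (hb.solution_bound (hw.pos (n + K)).le (hp _) (hp0 _) n).2
    have h3 := hw.le_mul_pow hb hp0 (n + K)
    have h4 : growthRate q s g m M * ξ (n + K) / q ^ n ≤
        growthRate q s g m M * (B / (q * (1 - q))) * q ^ K := by
      calc _ ≤ growthRate q s g m M * (B / (q * (1 - q)) * q ^ (n + K)) / q ^ n := by gcongr
        _ = _ := by
          rw [pow_add]
          field_simp
    have h5 := Real.exp_le_exp.2 h4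
    have h6 : 1 / 2 ≤ p (ξ (n + K)) n := by
      have := (abs_le.1 h2).1
      linarith
    have h7 : (1 / 2 : ℝ) ^ 2 ≤ p (ξ (n + K)) n ^ 2 := by gcongr
    have h8 := hb.le_h n
    calc m / (4 * s ^ K) * s ^ (n + K) = m * s ^ n * (1 / 2) ^ 2 := by
          rw [pow_add]
          field_simp
          norm_num
      _ ≤ h α γ n * p (ξ (n + K)) n ^ 2 := by
          have := hb.h_pos n
          gcongr
      _ ≤ _ := h1

theorem exists_separation (hw : IsEigenSystem α γ e p ξ w) (hb : GeomBounds α γ q s B g m M)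
    (hp : ∀ x, IsSolution α γ x (p x)) (hp0 : ∀ x, p x 0 = 1) :
    ∃ δ, 0 < δ ∧ ∀ k, δ ≤ 1 - ξ (k + 1) / ξ k := by
  have hq := hb.q_pos
  have hρ := hb.growthRate_pos
  have hM := hb.M_pos
  have hs : 0 < s := by linarith [hb.one_lt_s]
  have hs1 : 0 < s - 1 := by linarith [hb.one_lt_s]
  obtain ⟨K, hK⟩ := hw.exists_tail_le hb hp0
  obtain ⟨c, hc0, hc⟩ := hw.exists_le_norm_sq hb hp hp0
  set E := Real.exp (growthRate q s g m M * (2 * (B / (q * (1 - q)))) / q ^ (K + 1)) with hE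
  have hE0 : 0 < E := Real.exp_pos _
  set A := E ^ 2 * (M * (s / (s - 1)) * s ^ (K + 1)) / c with hA
  have hA0 : 0 < A := by positivity
  refine ⟨2 / (3 * A), by positivity, fun k => ?_⟩
  set d := 1 - ξ (k + 1) / ξ k with hd
  have hx := hw.pos k
  have hy := hw.pos (k + 1)
  have hyx : ξ (k + 1) < ξ k := hw.anti k.lt_succ_self
  have hd0 : 0 ≤ d := by
    rw [hd, sub_nonneg, div_le_one hx]
    exact hyx.le
  have hd1 : d ≤ 1 := by
    rw [hd]
    have := div_pos hy hx
    linarith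
  -- A common cut-off, at which both `w k` and `w (k + 1)` have small tails.
  set n := k + (K + 1) with hn
  have hdx : |ξ k - ξ (k + 1)| ≤ d * ξ k := by
    rw [abs_of_pos (by linarith), hd, sub_mul, div_mul_cancel₀ _ hx.ne', one_mul]
  have hdiff : ∀ j ≤ n, |p (ξ k) j - p (ξ (k + 1)) j| ≤ d * E := by
    intro j hj
    have h1 := hb.solution_lipschitz hx.le hy.le le_rfl hyx.le hdx hd0 hx (hp _) (hp0 _) (hp _)
      (hp0 _) j
    refine h1.trans (mul_le_mul_of_nonneg_left ?_ hd0)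
    have h2 : growthRate q s g m M * (2 * ξ k) / q ^ j ≤
        growthRate q s g m M * (2 * (B / (q * (1 - q)))) / q ^ (K + 1) := by
      refine (hb.div_pow_mono (by positivity) hj).trans ?_
      have h1 := hw.le_mul_pow hb hp0 k
      calc _ ≤ growthRate q s g m M * (2 * (B / (q * (1 - q)) * q ^ k)) / q ^ n := by gcongr
        _ = _ := by
          rw [hn, pow_add]
          field_simp
    have := Real.exp_le_exp.2 h2
    linarith
  have h1 := norm_sq_le_of_orthogonal e n (hw.orthogonal hb k.lt_succ_self.ne)
    (hK k n (by omega)) (hK (k + 1) n (by omega))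
  have h2 : ‖head e n (w k - w (k + 1))‖ ^ 2 ≤ (d * E) ^ 2 * (M * (s / (s - 1)) * s ^ n) := by
    rw [norm_sq_head]
    calc _ ≤ ∑ j ∈ Finset.range n, (d * E) ^ 2 * h α γ j := by
          refine Finset.sum_le_sum fun j hj => ?_
          rw [inner_sub_right, hw.inner_eq, hw.inner_eq, ← mul_sub, mul_pow,
            Real.sq_sqrt (hb.h_pos j).le, mul_comm, ← sq_abs]
          have := hdiff j (Finset.mem_range.1 hj).le
          have := hb.h_pos j
          gcongr
      _ ≤ _ := by
          rw [← Finset.mul_sum]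
          gcongr
          exact sum_h_range_le hb _
  have h3 : (d * E) ^ 2 * (M * (s / (s - 1)) * s ^ n) = d ^ 2 * A * (c * s ^ k) := by
    rw [hA, hn, pow_add]
    field_simp
  have h4 : 0 < ‖w k‖ ^ 2 := lt_of_lt_of_le (by positivity) (hc k)
  have h5 : 2 / 3 ≤ d ^ 2 * A := by
    refine le_of_mul_le_mul_right ?_ h4
    calc _ ≤ _ := h1
      _ ≤ _ := h2
      _ = _ := h3
      _ ≤ _ := by gcongr; exact hc k
  -- Since `0 ≤ d ≤ 1`, the quadratic bound `2 / 3 ≤ d ^ 2 * A` gives a linear one.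
  have h6 : d ^ 2 ≤ d := by nlinarith
  rw [div_le_iff₀ (by positivity)]
  nlinarith [mul_le_mul_of_nonneg_right h6 hA0.le]

end IsEigenSystem

end OrthPoly

/-! ### Uniqueness of the orthogonality measure -/

namespace OrthPoly

section Uniqueness

variable {α γ : ℕ → ℝ} {R : ℕ → ℝ[X]} {μ ν : Measure ℝ}

/-- The span contains 1 and, by the recurrence, is stable under multiplication by X. -/
theorem NormalizedRecurrence.span_range_eq_top (hR : NormalizedRecurrence α γ R) :
    Submodule.span ℝ (Set.range R) = ⊤ := by
  set S := Submodule.span ℝ (Set.range R) with hS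
  have hmem : ∀ n, R n ∈ S := fun n => Submodule.subset_span (Set.mem_range_self n)
  have hXR : ∀ n, X * R n ∈ S := by
    intro n
    cases n with
    | zero =>
      rw [hR.rec_zero, ← smul_eq_C_mul, ← smul_eq_C_mul]
      exact S.add_mem (S.neg_mem (S.smul_mem _ (hmem _))) (S.smul_mem _ (hmem _))
    | succ n =>
      rw [hR.rec_succ, ← smul_eq_C_mul, ← smul_eq_C_mul, ← smul_eq_C_mul]
      exact S.sub_mem (S.add_mem (S.neg_mem (S.smul_mem _ (hmem _))) (S.smul_mem _ (hmem _)))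
        (S.smul_mem _ (hmem _))
  have hX : ∀ f ∈ S, X * f ∈ S := by
    intro f hf
    induction hf using Submodule.span_induction with
    | mem x hx => obtain ⟨n, rfl⟩ := hx; exact hXR n
    | zero => simp
    | add x y _ _ hx hy => rw [mul_add]; exact S.add_mem hx hy
    | smul a x _ hx => rw [mul_smul_comm]; exact S.smul_mem a hx
  have hpow : ∀ n, (X : ℝ[X]) ^ n ∈ S := by
    intro n
    induction n with
    | zero => rw [pow_zero, ← hR.R_zero]; exact hmem 0
    | succ n ih => rw [pow_succ']; exact hX _ ih
  rw [Submodule.eq_top_iff']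
  intro f
  induction f using Polynomial.induction_on' with
  | add f g hf hg => exact S.add_mem hf hg
  | monomial n a => rw [← C_mul_X_pow_eq_monomial, ← smul_eq_C_mul]; exact S.smul_mem _ (hpow n)

theorem IsOrthogonalityMeasure.integrable_eval (hμ : IsOrthogonalityMeasure R μ) (f : ℝ[X]) :
    Integrable (fun x => f.eval x) μ := by
  induction f using Polynomial.induction_on' with
  | add f g hf hg => simpa using! hf.add hg
  | monomial n a => simpa using (hμ.integrable_pow n).const_mul a

/-- Orthogonality to `R 0 = 1` makes `R n` integrate to 0 for n > 0, and the total mass is 1; so all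
moments are determined. -/
theorem integral_eval_eq (hR : NormalizedRecurrence α γ R) (hμ : IsOrthogonalityMeasure R μ)
    (hν : IsOrthogonalityMeasure R ν) (f : ℝ[X]) :
    ∫ x, f.eval x ∂μ = ∫ x, f.eval x ∂ν := by
  have := hμ.isProbabilityMeasure
  have := hν.isProbabilityMeasure
  have hf : f ∈ Submodule.span ℝ (Set.range R) := hR.span_range_eq_top ▸ Submodule.mem_top
  induction hf using Submodule.span_induction with
  | mem x hx =>
    obtain ⟨n, rfl⟩ := hx
    rcases eq_or_ne n 0 with rfl | hn
    · simp [hR.R_zero]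
    · have h1 := hμ.orthogonal n 0 hn
      have h2 := hν.orthogonal n 0 hn
      simp only [hR.R_zero, eval_one, mul_one] at h1 h2
      rw [h1, h2]
  | zero => simp
  | add x y _ _ hx hy =>
    simp only [eval_add]
    rw [integral_add (hμ.integrable_eval x) (hμ.integrable_eval y),
      integral_add (hν.integrable_eval x) (hν.integrable_eval y), hx, hy]
  | smul a x _ hx =>
    simp only [eval_smul, smul_eq_mul]
    rw [integral_const_mul, integral_const_mul, hx]

/-- A measure whose even moments grow at most like `r ^ (2 n)` is concentrated on `[-r, r]`. -/
theorem measure_compl_eq_zero_of_moments [IsFiniteMeasure ν] {r : ℝ} (hr : 0 < r)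
    (hint : ∀ n : ℕ, Integrable (fun x : ℝ => x ^ n) ν)
    (hmom : ∀ n : ℕ, ∫ x, x ^ (2 * n) ∂ν ≤ r ^ (2 * n)) : ν (Set.Icc (-r) r)ᶜ = 0 := by
  -- Markov's inequality for `x ^ (2 * n)` bounds the mass by `(r / t) ^ (2 * n)`, which tends to 0.
  have key : ∀ t, r < t → ν {x | t ≤ |x|} = 0 := by
    intro t ht
    have ht0 : 0 < t := hr.trans ht
    have h1 : ∀ n : ℕ, ν.real {x | t ≤ |x|} ≤ ((r / t) ^ 2) ^ n := by
      intro n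
      have h2 := mul_meas_ge_le_integral_of_nonneg (μ := ν) (f := fun x : ℝ => x ^ (2 * n))
        (Eventually.of_forall fun x => by
          simp only [Pi.zero_apply]
          rw [pow_mul]
          positivity) (hint (2 * n)) (t ^ (2 * n))
      have h3 : ν.real {x | t ≤ |x|} ≤ ν.real {x : ℝ | t ^ (2 * n) ≤ x ^ (2 * n)} := by
        refine measureReal_mono fun x hx => ?_
        have hx' : t ≤ |x| := hx
        change t ^ (2 * n) ≤ x ^ (2 * n)
        rw [pow_mul, pow_mul, ← sq_abs x]
        gcongr
      rw [← pow_mul, div_pow, le_div_iff₀ (by positivity), mul_comm]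
      calc _ ≤ _ := mul_le_mul_of_nonneg_left h3 (by positivity)
        _ ≤ _ := h2
        _ ≤ _ := hmom n
    have h4 : Tendsto (fun n : ℕ => ((r / t) ^ 2) ^ n) atTop (𝓝 0) := by
      have : r / t < 1 := (div_lt_one ht0).2 ht
      exact tendsto_pow_atTop_nhds_zero_of_lt_one (by positivity)
        (pow_lt_one₀ (by positivity) this two_ne_zero)
    have h5 : ν.real {x | t ≤ |x|} ≤ 0 := ge_of_tendsto' h4 h1
    exact (measureReal_eq_zero_iff).1 (le_antisymm h5 measureReal_nonneg)
  have hsub : (Set.Icc (-r) r)ᶜ ⊆ ⋃ n : ℕ, {x : ℝ | r + 1 / (n + 1) ≤ |x|} := by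
    intro x hx
    have hx' : r < |x| := by
      rw [Set.mem_compl_iff, Set.mem_Icc, ← abs_le] at hx
      exact not_le.1 hx
    obtain ⟨n, hn⟩ := exists_nat_one_div_lt (sub_pos.2 hx')
    exact Set.mem_iUnion.2 ⟨n, by simp only [Set.mem_ofPred_eq]; linarith⟩
  refine measure_mono_null hsub (measure_iUnion_null fun n => key _ ?_)
  have : (0 : ℝ) < 1 / (n + 1) := by positivity
  linarith

theorem abs_integral_sub_le [IsProbabilityMeasure μ] {a b ε : ℝ} {f g : ℝ → ℝ}
    (hμ : μ (Set.Icc a b)ᶜ = 0) (hf : Integrable f μ) (hg : Integrable g μ)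
    (hfg : ∀ x ∈ Set.Icc a b, |f x - g x| < ε) : |∫ x, f x ∂μ - ∫ x, g x ∂μ| ≤ ε := by
  rw [← integral_sub hf hg]
  have h1 : ∀ᵐ x ∂μ, ‖f x - g x‖ ≤ ε := by
    have : ∀ᵐ x ∂μ, x ∈ Set.Icc a b := hμ
    filter_upwards [this] with x hx
    exact (hfg x hx).le
  simpa using norm_integral_le_of_norm_le_const h1

/-- Orthogonality measures are unique if one of them has bounded support. -/
theorem IsOrthogonalityMeasure.eq_of_bounded (hR : NormalizedRecurrence α γ R)
    (hμ : IsOrthogonalityMeasure R μ) (hν : IsOrthogonalityMeasure R ν) {r : ℝ} (hr : 0 < r)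
    (hμr : μ (Set.Icc (-r) r)ᶜ = 0) : ν = μ := by
  have := hμ.isProbabilityMeasure
  have := hν.isProbabilityMeasure
  have hνr : ν (Set.Icc (-r) r)ᶜ = 0 := by
    refine measure_compl_eq_zero_of_moments hr hν.integrable_pow fun n => ?_
    have h1 := integral_eval_eq hR hν hμ (X ^ (2 * n))
    simp only [eval_pow, eval_X] at h1
    rw [h1]
    have h2 : ∀ᵐ x ∂μ, x ^ (2 * n) ≤ r ^ (2 * n) := by
      have : ∀ᵐ x ∂μ, x ∈ Set.Icc (-r) r := hμr
      filter_upwards [this] with x hx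
      rw [pow_mul, pow_mul, ← sq_abs x]
      have := abs_le.2 hx
      gcongr
    simpa using integral_mono_ae (hμ.integrable_pow _) (integrable_const _) h2
  refine ext_of_forall_integral_eq_of_IsFiniteMeasure fun f => ?_
  have hfμ : Integrable f μ := f.integrable μ
  have hfν : Integrable f ν := f.integrable ν
  refine eq_of_abs_sub_le_all fun ε hε => ?_
  -- Weierstrass approximation on an interval carrying both measures reduces continuous functions to
  -- polynomials.
  obtain ⟨P, hP⟩ := exists_polynomial_near_of_continuousOn (-r) r f f.continuous.continuousOn
    (ε / 2) (by positivity)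
  have hP' : ∀ x ∈ Set.Icc (-r) r, |f x - P.eval x| < ε / 2 := fun x hx => by
    rw [abs_sub_comm]; exact hP x hx
  have h1 := abs_integral_sub_le hμr hfμ (hμ.integrable_eval P) hP'
  have h2 := abs_integral_sub_le hνr hfν (hν.integrable_eval P) hP'
  have h3 := integral_eval_eq hR hμ hν P
  rw [h3, abs_sub_comm] at h1
  calc _ ≤ _ := abs_sub_le _ (∫ x, P.eval x ∂ν) _
    _ ≤ ε := by linarith

end Uniqueness

end OrthPoly

/-! ### The discrete measure and the final assembly -/

namespace OrthPoly

open scoped InnerProductSpace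

theorem RatioHasPosLimit.exists_le {a b : ℕ → ℝ} (hab : RatioHasPosLimit a b)
    (hb : ∀ n, 0 < b n) : ∃ C, 0 < C ∧ ∀ n, a n ≤ C * b n := by
  obtain ⟨L, -, hL⟩ := hab
  obtain ⟨C, hC⟩ := hL.bddAbove_range
  refine ⟨max C 1, by positivity, fun n => ?_⟩
  rw [← div_le_iff₀ (hb n)]
  exact (hC (Set.mem_range_self n)).trans (le_max_left _ _)

theorem RatioHasPosLimit.exists_ge {a b : ℕ → ℝ} (hab : RatioHasPosLimit a b)
    (ha : ∀ n, 0 < a n) : ∃ c, 0 < c ∧ ∀ n, c * b n ≤ a n := by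
  obtain ⟨L, hL0, hL⟩ := hab
  obtain ⟨C, hC0, hC⟩ := RatioHasPosLimit.exists_le (a := b) (b := a)
    ⟨L⁻¹, inv_pos.2 hL0, by simpa using! hL.inv₀ hL0.ne'⟩ ha
  refine ⟨C⁻¹, inv_pos.2 hC0, fun n => ?_⟩
  rw [inv_mul_le_iff₀ hC0]
  exact hC n

theorem exists_geomBounds {α γ : ℕ → ℝ} {q s : ℝ} (hαpos : ∀ n, 0 < α (n + 1))
    (hγpos : ∀ n, 0 < γ n) (hq0 : 0 < q) (hq1 : q < 1)
    (hα : RatioHasPosLimit α fun n => q ^ n) (hγ : RatioHasPosLimit γ fun n => q ^ n) (hs : 1 < s)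
    (hh : SimFrom 0 (h α γ) fun n => s ^ n) :
    ∃ B g m M, GeomBounds α γ q s B g m M := by
  have hqn : ∀ n : ℕ, 0 < q ^ n := fun n => pow_pos hq0 n
  have hsn : ∀ n : ℕ, 0 < s ^ n := fun n => pow_pos (by linarith) n
  obtain ⟨A, hA0, hA⟩ := hα.exists_le hqn
  obtain ⟨C, hC0, hC⟩ := hγ.exists_le hqn
  obtain ⟨g, hg0, hg⟩ := hγ.exists_ge hγpos
  obtain ⟨m, M, hm0, hmM⟩ := hh
  refine ⟨C + A, g, m, M, hq0, hq1, hs, hαpos, hγpos, fun n => ?_, hg0, hg, hm0, fun n => ?_,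
    fun n => ?_⟩
  · have h1 : q ^ (n + 1) ≤ q ^ n := pow_le_pow_of_le_one hq0.le hq1.le n.le_succ
    have h2 : A * q ^ (n + 1) ≤ A * q ^ n := by gcongr
    linarith [hA (n + 1), hC n]
  · exact (le_div_iff₀ (hsn n)).1 (hmM n n.zero_le).1
  · exact (div_le_iff₀ (hsn n)).1 (hmM n n.zero_le).2

/-- The measure with masses `a k` at the points `ξ k`. -/
noncomputable def discreteMeasure (a ξ : ℕ → ℝ) : Measure ℝ :=
  Measure.sum fun k => ENNReal.ofReal (a k) • Measure.dirac (ξ k)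

theorem discreteMeasure_apply_eq_zero {a ξ : ℕ → ℝ} {A : Set ℝ} (hA : MeasurableSet A)
    (hξ : ∀ k, ξ k ∉ A) : discreteMeasure a ξ A = 0 := by
  rw [discreteMeasure, Measure.sum_apply _ hA]
  simp [hA, hξ]

theorem le_discreteMeasure_singleton (a ξ : ℕ → ℝ) (k : ℕ) :
    ENNReal.ofReal (a k) ≤ discreteMeasure a ξ {ξ k} := by
  refine le_trans ?_ (Measure.le_sum_apply _ _ |>.trans' (ENNReal.le_tsum k))
  simp

theorem hasSum_integral_discreteMeasure {a ξ : ℕ → ℝ} (ha : ∀ k, 0 ≤ a k) (hsum : Summable a)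
    {f : ℝ → ℝ} {C : ℝ} (hf : ∀ k, |f (ξ k)| ≤ C) :
    Integrable f (discreteMeasure a ξ) ∧
      HasSum (fun k => a k * f (ξ k)) (∫ x, f x ∂discreteMeasure a ξ) := by
  have hint : Integrable f (discreteMeasure a ξ) := by
    refine integrable_sum_dirac (fun _ => ENNReal.ofReal_ne_top) ?_
    refine Summable.of_nonneg_of_le (fun k => by positivity) (fun k => ?_) (hsum.mul_right C)
    rw [ENNReal.toReal_ofReal (ha k)]
    exact mul_le_mul_of_nonneg_left (hf k) (ha k)
  refine ⟨hint, (hasSum_integral_measure hint).congr_fun fun k => ?_⟩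
  simp [integral_smul_measure, ENNReal.toReal_ofReal (ha k)]

theorem isProbabilityMeasure_discreteMeasure {a ξ : ℕ → ℝ} (ha : ∀ k, 0 ≤ a k)
    (hsum : HasSum a 1) : IsProbabilityMeasure (discreteMeasure a ξ) := by
  refine ⟨?_⟩
  rw [discreteMeasure, Measure.sum_apply _ MeasurableSet.univ]
  simp [← ENNReal.ofReal_tsum_of_nonneg ha hsum.summable, hsum.tsum_eq]

theorem real_discreteMeasure_Icc_le {a ξ : ℕ → ℝ} (ha : ∀ k, 0 ≤ a k) (hsum : Summable a)
    (hξ : StrictAnti ξ) {C s : ℝ} (hs : 1 < s) (haC : ∀ k, a k ≤ C * (s⁻¹) ^ k) (k : ℕ) :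
    (discreteMeasure a ξ).real (Set.Icc 0 (ξ k)) ≤ C * (s / (s - 1)) * (s⁻¹) ^ k := by
  have hs0 : 0 < s := by linarith
  have hs1 : 0 < s - 1 := by linarith
  have h1 := (hasSum_integral_discreteMeasure (ξ := ξ) ha hsum
    (f := (Set.Icc 0 (ξ k)).indicator 1) (C := 1) fun i => by
      by_cases hi : ξ i ∈ Set.Icc 0 (ξ k) <;> simp [hi]).2
  rw [integral_indicator_one measurableSet_Icc] at h1
  have h2 := (hasSum_nat_add_iff' k).2 h1
  -- Atoms with index below k lie to the right of `ξ k`, so only a geometric tail remains.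
  rw [Finset.sum_eq_zero, sub_zero] at h2
  · have h3 := (hasSum_geometric_of_lt_one (inv_pos.2 hs0).le (inv_lt_one_of_one_lt₀ hs)).mul_left
      (C * (s⁻¹) ^ k)
    have h4 := hasSum_le (fun i => ?_) h2 h3
    · refine h4.trans (le_of_eq ?_)
      have : (1 - s⁻¹)⁻¹ = s / (s - 1) := by
        rw [inv_eq_iff_eq_inv, inv_div]
        field_simp
      rw [this]
      ring
    · have h5 := haC (i + k)
      have h6 : C * s⁻¹ ^ k * s⁻¹ ^ i = C * s⁻¹ ^ (i + k) := by rw [pow_add]; ring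
      rw [h6]
      refine le_trans ?_ h5
      by_cases hi : ξ (i + k) ∈ Set.Icc 0 (ξ k)
      · simp [hi]
      · simpa [hi] using ha (i + k)
  · intro i hi
    have h3 : ξ i ∉ Set.Icc 0 (ξ k) := fun h => absurd h.2 (not_le.2 (hξ (Finset.mem_range.1 hi)))
    simp [h3]

variable {F : Type*} [NormedAddCommGroup F] [InnerProductSpace ℝ F] [CompleteSpace F]

theorem IsEigenSystem.hasSum_weights {α γ : ℕ → ℝ} {q s B g m M : ℝ} {e : HilbertBasis ℕ ℝ F}
    {p : ℝ → ℕ → ℝ} {ξ : ℕ → ℝ} {w : ℕ → F} (hw : IsEigenSystem α γ e p ξ w)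
    (hb : GeomBounds α γ q s B g m M) (hp0 : ∀ x, p x 0 = 1) :
    HasSum (fun k => 1 / ‖w k‖ ^ 2) 1 := by
  have h1 := hw.hasSum_inner_mul_inner hb hp0 (e 0) (e 0)
  rw [inner_basis, if_pos rfl] at h1
  refine h1.congr_fun fun k => ?_
  rw [real_inner_comm, hw.inner_eq, hp0, h_zero]
  simp

theorem IsEigenSystem.isOrthogonalityMeasure {α γ : ℕ → ℝ} {q s B g m M : ℝ} {R : ℕ → ℝ[X]}
    (hR : NormalizedRecurrence α γ R) {e : HilbertBasis ℕ ℝ F} {ξ : ℕ → ℝ} {w : ℕ → F}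
    (hw : IsEigenSystem α γ e (fun x n => (R n).eval x) ξ w) (hb : GeomBounds α γ q s B g m M) :
    IsOrthogonalityMeasure R (discreteMeasure (fun k => 1 / ‖w k‖ ^ 2) ξ) := by
  have hp0 : ∀ x, (R 0).eval x = 1 := fun x => by rw [hR.R_zero, eval_one]
  have ha : ∀ k, 0 ≤ 1 / ‖w k‖ ^ 2 := fun k => by positivity
  have hsum := hw.hasSum_weights hb hp0
  have hbd : ∀ f : ℝ → ℝ, Continuous f → ∃ C, ∀ k, |f (ξ k)| ≤ C := by
    intro f hf
    obtain ⟨C, hC⟩ := (isCompact_Icc (a := 0) (b := ξ 0)).exists_bound_of_continuousOn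
      hf.continuousOn
    exact ⟨C, fun k => hC _ ⟨(hw.pos k).le, hw.anti.antitone k.zero_le⟩⟩
  refine ⟨isProbabilityMeasure_discreteMeasure ha hsum, fun n => ?_, fun i j hij => ?_⟩
  · obtain ⟨C, hC⟩ := hbd (fun x => x ^ n) (continuous_pow n)
    exact (hasSum_integral_discreteMeasure (f := fun x => x ^ n) ha hsum.summable hC).1
  · obtain ⟨C, hC⟩ := hbd (fun x => (R i).eval x * (R j).eval x)
      ((R i).continuous.mul (R j).continuous)
    have h1 := (hasSum_integral_discreteMeasure (f := fun x => (R i).eval x * (R j).eval x) ha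
      hsum.summable hC).2
    have h2 := hw.hasSum_inner_mul_inner hb hp0 (e i) (e j)
    -- Parseval for `e i` and `e j`: up to the factor `√(h i) * √(h j)` the series is the integral
    -- of `R i * R j`.
    rw [inner_basis, if_neg hij] at h2
    have h3 := h1.mul_left (√(h α γ i) * √(h α γ j))
    have h4 : √(h α γ i) * √(h α γ j) *
        ∫ x, (R i).eval x * (R j).eval x ∂discreteMeasure (fun k => 1 / ‖w k‖ ^ 2) ξ = 0 := by
      refine h3.unique (h2.congr_fun fun k => ?_)
      rw [real_inner_comm, hw.inner_eq, real_inner_comm, hw.inner_eq]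
      ring
    exact (mul_eq_zero.1 h4).resolve_left
      (mul_pos (Real.sqrt_pos.2 (hb.h_pos i)) (Real.sqrt_pos.2 (hb.h_pos j))).ne'

end OrthPoly

theorem theorem1 (α γ : ℕ → ℝ) (R : ℕ → ℝ[X])
    (hR : OrthPoly.NormalizedRecurrence α γ R)
    (q κ s c : ℝ) (N : ℕ)
    (hq0 : 0 < q) (hq1 : q < 1)
    (hα : OrthPoly.RatioHasPosLimit α (fun n => q ^ n))
    (hγ : OrthPoly.RatioHasPosLimit γ (fun n => q ^ n))
    (hκ1 : 1 ≤ κ) (hκ2 : κ < q⁻¹ + q - 1)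
    (hαγ : ∀ n, α n ≤ κ * γ n)
    (hs : 1 < s)
    (hh : OrthPoly.SimFrom 0 (OrthPoly.h α γ) (fun n => s ^ n))
    (hc1 : (1 + q) / (1 + q ^ 2) < c) (hc2 : c < 1 / q)
    (hlam : ∀ n, OrthPoly.lam α γ n ≤ OrthPoly.beta α γ (n + 1) - c * OrthPoly.beta α γ (n + 2))
    (hβ : OrthPoly.beta α γ 1 ≤ OrthPoly.beta α γ 0)
    (hβc : ∀ n, N ≤ n →
      OrthPoly.beta α γ (n + 1) - c * OrthPoly.beta α γ (n + 2) ≤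
        OrthPoly.beta α γ n - c * OrthPoly.beta α γ (n + 1)) :
    ∃ μ : Measure ℝ,
      -- `μ` is the unique orthogonality measure
      OrthPoly.IsOrthogonalityMeasure R μ ∧
      (∀ ν : Measure ℝ, OrthPoly.IsOrthogonalityMeasure R ν → ν = μ) ∧
      ∃ ξ : ℕ → ℝ,
        -- `μ` is concentrated on the decreasing sequence `ξ 1 > ξ 2 > ⋯`, each term being an atom
        StrictAntiOn ξ (Set.Ici 1) ∧
        μ (ξ '' Set.Ici 1)ᶜ = 0 ∧
        (∀ n, 1 ≤ n → 0 < μ {ξ n}) ∧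
        OrthPoly.SimFrom 1 ξ (fun n => q ^ n) ∧
        (∃ δ : ℝ, 0 < δ ∧ ∀ n, 1 ≤ n → δ ≤ 1 - ξ (n + 1) / ξ n) ∧
        μ {0} = 0 ∧
        OrthPoly.SimFrom 1 (fun n => μ.real (Set.Icc 0 (ξ n))) (fun n => (s ^ n)⁻¹) := by
  obtain ⟨B, g, m, M, hb⟩ := OrthPoly.exists_geomBounds hR.alpha_pos hR.gamma_pos hq0 hq1 hα hγ hs hh
  have hs0 : 0 < s := by linarith
  have hp : ∀ x, OrthPoly.IsSolution α γ x fun n => (R n).eval x := hR.isSolution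
  have hp0 : ∀ x, (R 0).eval x = 1 := fun x => by rw [hR.R_zero, eval_one]
  let e : HilbertBasis ℕ ℝ (lp (fun _ : ℕ => ℝ) 2) :=
    HilbertBasis.ofRepr (LinearIsometryEquiv.refl ℝ _)
  obtain ⟨ξ, w, hw⟩ := hb.exists_isEigenSystem e (p := fun x n => (R n).eval x) hp hp0
  obtain ⟨C, hC0, hC⟩ := hw.exists_norm_sq_le hb hp hp0
  obtain ⟨d, hd0, hd⟩ := hw.exists_le_norm_sq hb hp hp0
  obtain ⟨δ, hδ0, hδ⟩ := hw.exists_separation hb hp hp0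
  have hwn : ∀ k, 0 < ‖w k‖ ^ 2 := fun k => lt_of_lt_of_le (by positivity) (hd k)
  have ha : ∀ k, 0 ≤ 1 / ‖w k‖ ^ 2 := fun k => (one_div_pos.2 (hwn k)).le
  have hsum := hw.hasSum_weights hb hp0
  have hρ := hb.growthRate_pos
  set μ := OrthPoly.discreteMeasure (fun k => 1 / ‖w k‖ ^ 2) ξ with hμdef
  have hμ : OrthPoly.IsOrthogonalityMeasure R μ := hw.isOrthogonalityMeasure hR hb
  have := hμ.isProbabilityMeasure
  have hatom : ∀ k, ENNReal.ofReal (1 / ‖w k‖ ^ 2) ≤ μ {ξ k} := fun k =>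
    OrthPoly.le_discreteMeasure_singleton (fun k => 1 / ‖w k‖ ^ 2) ξ k
  -- Eigenvalues are numbered from 0 and the theorem counts from 1, hence `ξ (n - 1)`; the shift
  -- costs factors q and s in the constants.
  refine ⟨μ, hμ, fun ν hν => hμ.eq_of_bounded hR hν (hw.pos 0) ?_, fun n => ξ (n - 1), ?_, ?_, ?_,
    ?_, ?_, ?_, ?_⟩
  · refine OrthPoly.discreteMeasure_apply_eq_zero measurableSet_Icc.compl fun k hk => hk ?_
    exact ⟨by linarith [hw.pos k, hw.pos 0], hw.anti.antitone k.zero_le⟩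
  · intro i hi j hj hij
    have hi' : 1 ≤ i := hi
    exact hw.anti (by omega)
  · refine OrthPoly.discreteMeasure_apply_eq_zero
      ((Set.to_countable (Set.Ici (1 : ℕ))).image _).measurableSet.compl fun k hk => hk ?_
    exact ⟨k + 1, Nat.le_add_left 1 k, rfl⟩
  · intro n _
    exact lt_of_lt_of_le (ENNReal.ofReal_pos.2 (one_div_pos.2 (hwn _))) (hatom _)
  · refine ⟨1 / OrthPoly.growthRate q s g m M, B / (q * (1 - q)) / q, by positivity,
      fun n hn => ?_⟩
    obtain ⟨k, rfl⟩ := Nat.exists_eq_add_of_le' hn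
    have h1 := hw.pow_le hb hp0 k
    have h2 := hw.le_mul_pow hb hp0 k
    simp only [Nat.add_sub_cancel]
    refine ⟨?_, ?_⟩
    · rw [div_le_div_iff₀ hρ (by positivity)]
      linarith
    · rw [div_le_iff₀ (by positivity)]
      refine h2.trans (le_of_eq ?_)
      rw [pow_succ]
      field_simp
  · refine ⟨δ, hδ0, fun n hn => ?_⟩
    obtain ⟨k, rfl⟩ := Nat.exists_eq_add_of_le' hn
    exact hδ k
  · exact OrthPoly.discreteMeasure_apply_eq_zero (measurableSet_singleton 0) fun k hk =>
      (hw.pos k).ne' hk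
  · refine ⟨s / C, 1 / d * (s / (s - 1)) * s, by positivity, fun n hn => ?_⟩
    obtain ⟨k, rfl⟩ := Nat.exists_eq_add_of_le' hn
    simp only [Nat.add_sub_cancel, div_inv_eq_mul]
    refine ⟨?_, ?_⟩
    -- For the lower bound the single atom at `ξ k` is enough.
    · have h1 : 1 / ‖w k‖ ^ 2 ≤ μ.real (Set.Icc 0 (ξ k)) := by
        have h2 : ENNReal.ofReal (1 / ‖w k‖ ^ 2) ≤ μ (Set.Icc 0 (ξ k)) :=
          (hatom k).trans (measure_mono (Set.singleton_subset_iff.2 ⟨(hw.pos k).le, le_rfl⟩))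
        exact (ENNReal.ofReal_le_iff_le_toReal (measure_ne_top _ _)).1 h2
      have h3 : 1 / (C * s ^ k) ≤ 1 / ‖w k‖ ^ 2 := one_div_le_one_div_of_le (hwn k) (hC k)
      calc s / C = 1 / (C * s ^ k) * s ^ (k + 1) := by
            rw [pow_succ]
            field_simp
        _ ≤ _ := mul_le_mul_of_nonneg_right (h3.trans h1) (by positivity)
    · have h1 := OrthPoly.real_discreteMeasure_Icc_le ha hsum.summable hw.anti hs
        (C := 1 / d) (fun i => by
          rw [inv_pow, ← one_div, one_div_mul_one_div]
          exact one_div_le_one_div_of_le (by positivity) (hd i)) k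
      calc _ ≤ 1 / d * (s / (s - 1)) * (s⁻¹) ^ k * s ^ (k + 1) :=
            mul_le_mul_of_nonneg_right h1 (by positivity)
        _ = _ := by
            rw [inv_pow, pow_succ]
            field_simp
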